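/- **Theorem 1.2 (Explicit solutions).** A *closed spherical curve* is a simple, continuously differentiable closed curve $\gamma:\mathbb S^1\cong\mathbb R/2\pi\mathbb Z\to\mathbb S^2:=\{x\in\mathbb R^3:|x|=1\}$. Its *thickness* is $\triangle[\gamma]:=\inf R(x,y,z)$, where the infimum runs over all triples of distinct points $x,y,z$ of the image of $\gamma$, and $R(x,y,z)$ is the radius of the circle through $x,y,z$. For $\Theta>0$, Problem (P) asks for a longest curve among all closed spherical curves $\gamma$ with $\triangle[\gamma]\ge\Theta$. Let $n\ge 1$ be an integer and $\vartheta_n:=\pi/(2n)$. Let $C_0,\dots,C_{n-1}\subset\mathbb S^2$ be the latitudinal circles $C_i:=\{p\in\mathbb S^2:\operatorname{dist}_{\mathbb S^2}(p,N)=(2i+1)\vartheta_n\}$, where $N$ is the north pole and $\operatorname{dist}_{\mathbb S^2}$ is the intrinsic distance on $\mathbb S^2$. Cut $\mathbb S^2$ along a great circle through the poles into a closed western and a closed eastern hemisphere. For $k\in\{0,\dots,n-1\}$ let $\Gamma_{n,k}$ be the union of the part of $C_0\cup\dots\cup C_{n-1}$ in the western hemisphere and of the image of its part in the eastern hemisphere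 under the rotation by the angle $2k\vartheta_n$ that maps the eastern hemisphere to itself. If $\gcd(k,n)=1$, then $\Gamma_{n,k}$ is the image of a single closed spherical curve $\gamma$ with nowhere vanishing derivative, which consists of finitely many circular arcs, has thickness $\triangle[\gamma]=\sin\vartheta_n$, is sphere-filling, i.e. $\operatorname{area}\{\xi\in\mathbb S^2:\operatorname{dist}_{\mathbb S^2}(\xi,\gamma)<\vartheta_n\}=4\pi=\operatorname{area}(\mathbb S^2)$, and solves Problem (P) for the prescribed minimal thickness $\Theta_n=\sin\vartheta_n$. For fixed $n$, this gives exactly $\varphi(n)$ different sets $\Gamma_{n,k}$, where $\varphi$ is Euler's totient function. -/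

import Mathlib

open Set MeasureTheory

namespace SphericalRope

/-- Euclidean 3-space; coordinates `p 0, p 1, p 2` play the role of `x, y, z`. -/
abbrev E3 : Type := EuclideanSpace ℝ (Fin 3)

/-- A closed spherical curve: a simple, continuously differentiable loop on the unit sphere `S²`,
given as a `2π`-periodic map on `ℝ`. (Being simple, it is not constant, so it has positive
length.) -/
structure IsClosedSphericalCurve (γ : ℝ → E3) : Prop where
  contDiff : ContDiff ℝ 1 γ
  periodic : Function.Periodic γ (2 * Real.pi)
  simple : Set.InjOn γ (Set.Ico 0 (2 * Real.pi))
  mem_sphere : ∀ t, γ t ∈ Metric.sphere (0 : E3) 1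

/-- The length of a closed `C¹` curve. -/
noncomputable def length (γ : ℝ → E3) : ℝ :=
  ∫ t in (0 : ℝ)..(2 * Real.pi), ‖deriv γ t‖

/-- The thickness of a set of points: the infimum of the circumradii `R(x, y, z)` over all triples
of distinct points `x, y, z` of the set. A collinear triple has infinite circumradius, so only the
non-degenerate triangles enter the infimum. -/
noncomputable def thickness (S : Set E3) : ENNReal :=
  ⨅ (T : Affine.Triangle ℝ E3) (_ : ∀ i, T.points i ∈ S), ENNReal.ofReal T.circumradius

/-- The curves that compete in the longest rope problem with prescribed minimal thickness `Θ`. -/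
def IsAdmissible (Θ : ℝ) (γ : ℝ → E3) : Prop :=
  IsClosedSphericalCurve γ ∧ ENNReal.ofReal Θ ≤ thickness (Set.range γ)

/-- The solutions of the longest rope problem: the longest closed curves `γ` on `S²` whose
thickness is at least `Θ`. -/
def IsLongestRope (Θ : ℝ) (γ : ℝ → E3) : Prop :=
  IsAdmissible Θ γ ∧ ∀ η : ℝ → E3, IsAdmissible Θ η → length η ≤ length γ

/-- The open spherical tubular neighbourhood of radius `θ` of a set of points of `S²`. The
intrinsic distance of two points of `S²` is the angle between them. -/
def tube (θ : ℝ) (S : Set E3) : Set (Metric.sphere (0 : E3) 1) :=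
  {ξ | ∃ p ∈ S, InnerProductGeometry.angle p (ξ : E3) < θ}

/-- The surface area of a subset of `S²`. -/
noncomputable def area (A : Set (Metric.sphere (0 : E3) 1)) : ENNReal :=
  (volume : Measure E3).toSphere A

/-- The tube of radius `θ` covers the full area `4π` of `S²`. -/
def IsSphereFilling (θ : ℝ) (S : Set E3) : Prop :=
  area (tube θ S) = ENNReal.ofReal (4 * Real.pi)

/-- The closed curve is made of finitely many consecutive circular arcs. -/
def IsPiecewiseCircular (γ : ℝ → E3) : Prop :=
  ∃ (m : ℕ) (t : ℕ → ℝ), t 0 = 0 ∧ t m = 2 * Real.pi ∧ (∀ i < m, t i < t (i + 1)) ∧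
    ∀ i < m, EuclideanGeometry.Concyclic (γ '' Set.Icc (t i) (t (i + 1)))

/-- The angle `ϑₙ = π / (2n)`. -/
noncomputable def theta (n : ℕ) : ℝ := Real.pi / (2 * n)

/-- The north pole `(0, 0, 1)`. -/
noncomputable def northPole : E3 := !₂[0, 0, 1]

/-- The latitudinal circle `Cᵢ` at spherical distance `ϑₙ + i · 2ϑₙ` from the north pole. -/
def latitudeCircle (n i : ℕ) : Set E3 :=
  {p | p ∈ Metric.sphere (0 : E3) 1 ∧
    InnerProductGeometry.angle northPole p = theta n + i * (2 * theta n)}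

/-- The stack of the `n` latitudinal circles `C₀, …, Cₙ₋₁`. -/
def stack (n : ℕ) : Set E3 := ⋃ i ∈ Finset.range n, latitudeCircle n i

/-- The closed half space containing the western hemisphere. It is bounded by the plane `y = 0`,
which meets `S²` in a longitudinal great circle. -/
def west : Set E3 := {p | p 1 ≤ 0}

/-- The closed half space containing the eastern hemisphere. -/
def east : Set E3 := {p | 0 ≤ p 1}

/-- The rotation by the angle `α` about the `y`-axis. It maps the eastern hemisphere to itself and
turns the longitudinal great circle `y = 0` within itself. -/
noncomputable def rotation (α : ℝ) (p : E3) : E3 :=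
  !₂[Real.cos α * p 0 + Real.sin α * p 2, p 1, -Real.sin α * p 0 + Real.cos α * p 2]

/-- The western half of the stack of `n` latitudinal circles, together with its eastern half turned
by the angle `2kϑₙ`. -/
noncomputable def turnedStack (n k : ℕ) : Set E3 :=
  (stack n ∩ west) ∪ rotation (2 * k * theta n) '' (stack n ∩ east)

end SphericalRope

namespace SphericalRope

/-! Optimality is an integral-geometric bound that the curves attain: every admissible curve has
length at most `2π / Θ` when `0 < Θ ≤ 1` (`length_le_of_le_thickness`), and the constructed ones
have length exactly `2π / sin ϑₙ`.

For the bound, take circles on the sphere of Euclidean radius `ρ < Θ`. Such a circle contains at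
most two points of the curve, since three would form a triangle of circumradius at most `ρ`. On the
other hand, the centres of the circles that separate two nearby points `x`, `y` fill a pair of lunes
of area about `4ρ‖x - y‖`. Integrating the number of separated edges of an inscribed polygon over
all centres, which have total area `4π`, gives `4ρL ≤ 2 · 4π` in the limit. The computation is done
with cones in the unit ball, so every area is replaced by a third of it (`exists_volume_lune_ge`,
`card_crossings_le`, `sum_norm_sub_le`).

For the thickness, a triangle of circumradius less than `sin ϑₙ` puts three points of the set on the
boundary of a cap of angular radius less than `ϑₙ`. Such a cap meets at most one circle of each of
the two stacks, because neighbouring circles are `2ϑₙ` apart. A line meets a circle at most twice,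
which excludes three points on one stack. Two points on one half stack and a third strictly on the
other side are excluded because the two halves have the same end points on the seam `y = 0`
(`half_stacks_three_points`).

The curve runs alternately through western and eastern half circles. All arcs cross the seam
orthogonally, so they join smoothly once their speeds agree there. Coprimality makes the walk visit
each half circle once before it closes after `2n` arcs (`injOn_loop`, `range_loop`). Its length is a
telescoping sum of sines (`sum_sin_odd_mul_theta`). Sphere-filling holds because each point off
finitely many midway circles is within `ϑₙ` of the stack on its own side. Distinct `k` give distinct
sets because the midpoint of a top eastern arc misses the other levels (`turnedStack_ne`). -/

/-! ### Circles on the sphere and circumradii -/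

/-- The point `q` projects to the circumcentre, so by Pythagoras `r` exceeds the circumradius unless
`q` lies in the span of the simplex. -/
theorem circumradius_le_of_dist_eq {n : ℕ} (T : Affine.Simplex ℝ E3 n) {q : E3} {r : ℝ}
    (h : ∀ i, dist (T.points i) q = r) : T.circumradius ≤ r := by
  have h1 := T.dist_circumcenter_sq_eq_sq_sub_circumradius h
    (T.orthogonalProjection_eq_circumcenter_of_dist_eq h)
    (subset_affineSpan ℝ _ (Set.mem_range_self 0))
  have hr : 0 ≤ r := (h 0) ▸ dist_nonneg
  exact (abs_le_of_sq_le_sq' (by nlinarith [sq_nonneg (dist q T.circumcenter)]) hr).2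

theorem thickness_le_of_dist_eq {S : Set E3} {p : Fin 3 → E3} (hp : Function.Injective p)
    (hS : ∀ i, p i ∈ S) {q : E3} {r : ℝ} (h : ∀ i, dist (p i) q = r) :
    thickness S ≤ ENNReal.ofReal r := by
  have hc : EuclideanGeometry.Cospherical (Set.range p) := ⟨q, r, by rintro _ ⟨i, rfl⟩; exact h i⟩
  let T : Affine.Triangle ℝ E3 := ⟨p, hc.affineIndependent Subset.rfl hp⟩
  refine (iInf₂_le T hS).trans (ENNReal.ofReal_le_ofReal ?_)
  exact circumradius_le_of_dist_eq T h

/-- The boundary of the cap about `c / ‖c‖` is a Euclidean circle, cut out by a plane at distance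
`|κ|` from the origin. -/
theorem dist_smul_eq {p c : E3} {κ : ℝ} (hp : ‖p‖ = 1) (hc : c ≠ 0)
    (h : inner ℝ p c = κ * ‖c‖) : dist p ((κ / ‖c‖) • c) = √(1 - κ ^ 2) := by
  have hc' : ‖c‖ ≠ 0 := norm_ne_zero_iff.2 hc
  rw [dist_eq_norm]
  rw [← Real.sqrt_sq (norm_nonneg _), norm_sub_sq_real, hp, inner_smul_right, h, norm_smul, norm_div,
    norm_norm, div_mul_cancel₀ _ hc', Real.norm_eq_abs, sq_abs]
  congr 1
  field_simp
  ring

/-! ### Volume of the cone over the two lunes between neighbouring caps -/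

/-- The frame coordinates `(z, (X, Y)) ↦ z b₀ + X b₁ + Y b₂`. -/
noncomputable def frame (b : OrthonormalBasis (Fin 3) ℝ E3) (q : ℝ × ℝ × ℝ) : E3 :=
  b.repr.symm (!₂[q.1, q.2.1, q.2.2])

/-- Allows volumes to be computed by slicing at constant `z` and using polar coordinates in each
slice. -/
theorem measurePreserving_frame (b : OrthonormalBasis (Fin 3) ℝ E3) :
    MeasurePreserving (frame b) volume volume := by
  have h1 := (volume_preserving_piFinSuccAbove (fun _ : Fin 3 => ℝ) 0).symm
  have h2 : MeasurePreserving (Prod.map id (MeasurableEquiv.finTwoArrow (α := ℝ)).symm)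
      (volume : Measure (ℝ × ℝ × ℝ)) (volume : Measure (ℝ × (Fin 2 → ℝ))) :=
    (MeasurePreserving.id _).prod (volume_preserving_finTwoArrow ℝ).symm
  have h3 := (EuclideanSpace.volume_preserving_symm_measurableEquiv_toLp (Fin 3)).symm
  have h4 := b.measurePreserving_repr_symm
  have := h4.comp (h3.comp (h1.comp h2))
  convert this using 1
  ext1 q
  simp only [frame, Function.comp]
  congr 1
  ext i
  fin_cases i <;> rfl

theorem frame_inner (b : OrthonormalBasis (Fin 3) ℝ E3) (q q' : ℝ × ℝ × ℝ) :
    inner ℝ (frame b q) (frame b q') = q.1 * q'.1 + q.2.1 * q'.2.1 + q.2.2 * q'.2.2 := by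
  simp [frame, Fin.sum_univ_three, PiLp.inner_apply]
  ring

theorem norm_frame (b : OrthonormalBasis (Fin 3) ℝ E3) (q : ℝ × ℝ × ℝ) :
    ‖frame b q‖ = √(q.1 ^ 2 + q.2.1 ^ 2 + q.2.2 ^ 2) := by
  simp [frame, EuclideanSpace.norm_eq, Fin.sum_univ_three]

theorem frame_eq (b : OrthonormalBasis (Fin 3) ℝ E3) (q : ℝ × ℝ × ℝ) :
    frame b q = q.1 • b 0 + q.2.1 • b 1 + q.2.2 • b 2 := by
  have := b.sum_repr_symm (!₂[q.1, q.2.1, q.2.2])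
  rw [frame, ← this]; simp [Fin.sum_univ_three]

/-- Two points of the unit sphere in a common frame, at the angles `-h` and `h`. -/
theorem exists_frame {x y : E3} (hx : ‖x‖ = 1) (hy : ‖y‖ = 1) (hxy : x ≠ y) (hd : ‖x - y‖ < 2) :
    ∃ b : OrthonormalBasis (Fin 3) ℝ E3,
      x = frame b (0, Real.cos (Real.arcsin (‖x - y‖ / 2)), - (‖x - y‖ / 2)) ∧
      y = frame b (0, Real.cos (Real.arcsin (‖x - y‖ / 2)), ‖x - y‖ / 2) := by
  set d := ‖x - y‖ with hd'
  have hd0 : 0 < d := norm_pos_iff.2 (sub_ne_zero.2 hxy)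
  have hpar := parallelogram_law_with_norm ℝ x y
  rw [hx, hy, ← hd'] at hpar
  have hs : ‖x + y‖ ≠ 0 := by intro h; rw [h] at hpar; nlinarith
  have hs0 : 0 < ‖x + y‖ := lt_of_le_of_ne (norm_nonneg _) (Ne.symm hs)
  have hcos : Real.cos (Real.arcsin (d / 2)) = ‖x + y‖ / 2 := by
    rw [Real.cos_arcsin, Real.sqrt_eq_iff_mul_self_eq_of_pos (by positivity)]
    nlinarith
  have horth : inner ℝ (x + y) (y - x) = 0 := by
    rw [inner_add_left, inner_sub_right, inner_sub_right, real_inner_self_eq_norm_sq,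
      real_inner_self_eq_norm_sq, hx, hy, real_inner_comm]; ring
  have hd2 : ‖y - x‖ = d := by rw [norm_sub_rev]
  let v : Fin 3 → E3 := ![0, ‖x + y‖⁻¹ • (x + y), d⁻¹ • (y - x)]
  have hv1 : ‖v 1‖ = 1 := by
    change ‖‖x + y‖⁻¹ • (x + y)‖ = 1
    rw [norm_smul, norm_inv, norm_norm, inv_mul_cancel₀ hs]
  have hv2 : ‖v 2‖ = 1 := by
    change ‖d⁻¹ • (y - x)‖ = 1
    rw [norm_smul, norm_inv, hd2, Real.norm_of_nonneg hd0.le, inv_mul_cancel₀ hd0.ne']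
  have hv12 : inner ℝ (v 1) (v 2) = 0 := by
    change inner ℝ (‖x + y‖⁻¹ • (x + y)) (d⁻¹ • (y - x)) = 0
    rw [inner_smul_left, inner_smul_right, horth]; simp
  have hv : Orthonormal ℝ (Set.domRestrict ({1, 2} : Set (Fin 3)) v) := by
    constructor
    · rintro ⟨i, hi⟩
      rcases hi with rfl | rfl
      exacts [hv1, hv2]
    · rintro ⟨i, hi⟩ ⟨j, hj⟩ hij
      rcases hi with rfl | rfl <;> rcases hj with rfl | rfl
      · exact absurd rfl hij
      · exact hv12
      · exact (real_inner_comm _ _).trans hv12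
      · exact absurd rfl hij
  obtain ⟨b, hb⟩ := hv.exists_orthonormalBasis_extension_of_card_eq (by simp)
  have hb1 : b 1 = ‖x + y‖⁻¹ • (x + y) := hb 1 (by simp)
  have hb2 : b 2 = d⁻¹ • (y - x) := hb 2 (by simp)
  refine ⟨b, ?_, ?_⟩
  · rw [frame_eq, hb1, hb2, hcos]
    simp only [smul_smul, zero_smul]
    rw [show ‖x + y‖ / 2 * ‖x + y‖⁻¹ = 1 / 2 by field_simp, show -(d / 2) * d⁻¹ = - (1 / 2) by field_simp]
    module
  · rw [frame_eq, hb1, hb2, hcos]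
    simp only [smul_smul, zero_smul]
    rw [show ‖x + y‖ / 2 * ‖x + y‖⁻¹ = 1 / 2 by field_simp, show (d / 2) * d⁻¹ = (1 / 2) by field_simp]
    module

/-- The vectors of the unit ball whose direction lies in exactly one of the caps
about `x` and `y` with the angular radius `arccos κ`. -/
def lune (κ : ℝ) (x y : E3) : Set E3 :=
  {c | c ∈ Metric.ball (0 : E3) 1 ∧ ¬ (κ * ‖c‖ < inner ℝ x c ↔ κ * ‖c‖ < inner ℝ y c)}

theorem measurableSet_lune (κ : ℝ) (x y : E3) : MeasurableSet (lune κ x y) := by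
  have h : ∀ x : E3, MeasurableSet {c : E3 | κ * ‖c‖ < inner ℝ x c} := fun x =>
    (isOpen_lt (by fun_prop) (by fun_prop)).measurableSet
  have e : lune κ x y = Metric.ball 0 1 ∩
      ({c : E3 | κ * ‖c‖ < inner ℝ x c} \ {c : E3 | κ * ‖c‖ < inner ℝ y c} ∪
       {c : E3 | κ * ‖c‖ < inner ℝ y c} \ {c : E3 | κ * ‖c‖ < inner ℝ x c}) := by
    ext c; simp only [lune, mem_ofPred_eq, mem_inter_iff, mem_union, mem_sdiff]; tauto
  rw [e]
  exact Metric.isOpen_ball.measurableSet.inter (((h x).diff (h y)).union ((h y).diff (h x)))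

theorem cos_separation {ω h φ : ℝ} (h0 : 0 < h) (hω : h < ω) (hω' : ω + 2 * h < Real.pi)
    (hφ : φ ∈ Ioo (ω - h) (ω + h) ∪ Ioo (-ω - h) (-ω + h)) :
    ¬ (Real.cos ω < Real.cos (φ + h) ↔ Real.cos ω < Real.cos (φ - h)) := by
  have key : ∀ t : ℝ, |t| < ω → Real.cos ω < Real.cos t := fun t ht => by
    rw [← Real.cos_abs t]
    exact Real.cos_lt_cos_of_nonneg_of_le_pi (abs_nonneg _) (by linarith) ht
  have key' : ∀ t : ℝ, ω ≤ |t| → |t| ≤ Real.pi → ¬ Real.cos ω < Real.cos t := fun t ht ht' => by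
    rw [← Real.cos_abs t, not_lt]
    exact Real.cos_le_cos_of_nonneg_of_le_pi (by linarith) ht' ht
  rcases hφ with hφ | hφ
  · have h1 := key (φ - h) (abs_lt.2 ⟨by linarith [hφ.1], by linarith [hφ.2]⟩)
    have h2 : |φ + h| = φ + h := abs_of_pos (by linarith [hφ.1])
    have h3 := key' (φ + h) (by rw [h2]; linarith [hφ.1]) (by rw [h2]; linarith [hφ.2])
    tauto
  · have h1 := key (φ + h) (abs_lt.2 ⟨by linarith [hφ.1], by linarith [hφ.2]⟩)
    have h2 : |φ - h| = h - φ := by rw [abs_of_neg (by linarith [hφ.2])]; ring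
    have h3 := key' (φ - h) (by rw [h2]; linarith [hφ.2]) (by rw [h2]; linarith [hφ.1])
    tauto

/-- In polar coordinates the inner products with the two points are `r cos (φ ± h)`, so membership
in each cap compares `φ ± h` with the threshold angle `ω`. -/
theorem frame_polar_mem_lune (b : OrthonormalBasis (Fin 3) ℝ E3) {κ ω h z r φ : ℝ}
    (hr : 0 < r) (hball : z ^ 2 + r ^ 2 < 1) (hω : κ * √(z ^ 2 + r ^ 2) = r * Real.cos ω)
    (h0 : 0 < h) (hω1 : h < ω) (hω2 : ω + 2 * h < Real.pi)
    (hφ : φ ∈ Ioo (ω - h) (ω + h) ∪ Ioo (-ω - h) (-ω + h)) :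
    frame b (z, r * Real.cos φ, r * Real.sin φ) ∈
      lune κ (frame b (0, Real.cos h, - Real.sin h)) (frame b (0, Real.cos h, Real.sin h)) := by
  have hn : ‖frame b (z, r * Real.cos φ, r * Real.sin φ)‖ = √(z ^ 2 + r ^ 2) := by
    rw [norm_frame]
    congr 1
    linear_combination r ^ 2 * Real.sin_sq_add_cos_sq φ
  refine ⟨?_, ?_⟩
  · rw [mem_ball_zero_iff, hn, Real.sqrt_lt' one_pos]; simpa using hball
  · rw [hn, frame_inner, frame_inner, hω]
    have h1 : (0 : ℝ) * z + Real.cos h * (r * Real.cos φ) + -Real.sin h * (r * Real.sin φ) =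
        r * Real.cos (φ + h) := by rw [Real.cos_add]; ring
    have h2 : (0 : ℝ) * z + Real.cos h * (r * Real.cos φ) + Real.sin h * (r * Real.sin φ) =
        r * Real.cos (φ - h) := by rw [Real.cos_sub]; ring
    simp only [h1, h2, mul_lt_mul_iff_right₀ hr]
    exact cos_separation h0 hω1 hω2 hφ

theorem lintegral_annulus {a b c : ℝ} (ha : 0 ≤ a) (hab : a ≤ b) (hc : 0 ≤ c) :
    ∫⁻ r in Ioo a b, ENNReal.ofReal (r * c) = ENNReal.ofReal ((b ^ 2 - a ^ 2) / 2 * c) := by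
  rw [← ofReal_integral_eq_lintegral_ofReal]
  · congr 1
    rw [← integral_Ioc_eq_integral_Ioo, ← intervalIntegral.integral_of_le hab,
      intervalIntegral.integral_mul_const, integral_id]
  · refine ((continuous_id.mul continuous_const).integrableOn_Icc (a := a) (b := b)).mono_set
      Ioo_subset_Icc_self
  · exact (ae_restrict_mem measurableSet_Ioo).mono fun r hr => mul_nonneg (ha.trans hr.1.le) hc

/-- For fixed `z` and `r` the separating angles contain two intervals of length `2h`, whatever the
threshold `ω` is; only a lower bound on `ω` is needed. The slice thus has area at least `4h ∫ r dr`.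
-/
theorem volume_slice_lune_ge (b : OrthonormalBasis (Fin 3) ℝ E3) {κ s h z : ℝ} (hκ : 0 < κ)
    (hs : 0 < s) (hκs : κ ^ 2 + s ^ 2 < 1) (h0 : 0 < h)
    (h1 : h < Real.arccos (κ / √(1 - s ^ 2))) (h4 : h < Real.pi / 4) (hz : z ∈ Ioo (-s) s) :
    ENNReal.ofReal (2 * h * (1 - z ^ 2 / s ^ 2)) ≤
      volume {p : ℝ × ℝ | frame b (z, p) ∈
        lune κ (frame b (0, Real.cos h, - Real.sin h)) (frame b (0, Real.cos h, Real.sin h))} := by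
  set M := {p : ℝ × ℝ | frame b (z, p) ∈
        lune κ (frame b (0, Real.cos h, - Real.sin h)) (frame b (0, Real.cos h, Real.sin h))} with hM
  have hMm : MeasurableSet M :=
    ((measurePreserving_frame b).measurable.comp measurable_prodMk_left) (measurableSet_lune _ _ _)
  have hs1 : s ^ 2 < 1 := by nlinarith
  have hz2 : z ^ 2 < s ^ 2 := sq_lt_sq' hz.1 hz.2
  -- The condition `A < r` says that the direction has a component of size less than `s` along `b
  -- 0`; `r < B` says that the vector lies in the unit ball.
  set A := √(z ^ 2 * (1 - s ^ 2) / s ^ 2)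
  set B := √(1 - z ^ 2)
  have hA2 : A ^ 2 = z ^ 2 * (1 - s ^ 2) / s ^ 2 :=
    Real.sq_sqrt (div_nonneg (mul_nonneg (sq_nonneg _) (by linarith)) (sq_nonneg _))
  have hB2 : B ^ 2 = 1 - z ^ 2 := Real.sq_sqrt (by linarith)
  have hA0 : 0 ≤ A := Real.sqrt_nonneg _
  have hB0 : 0 ≤ B := Real.sqrt_nonneg _
  have hdiff : B ^ 2 - A ^ 2 = 1 - z ^ 2 / s ^ 2 := by rw [hA2, hB2]; field_simp; ring
  have hpos : 0 ≤ 1 - z ^ 2 / s ^ 2 := by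
    rw [sub_nonneg, div_le_one (by positivity)]; exact hz2.le
  have hAB : A ≤ B := by
    refine abs_le_of_sq_le_sq' ?_ hB0 |>.2
    linarith
  have hin : ∀ r ∈ Ioo A B, ENNReal.ofReal (r * (4 * h)) ≤
      ∫⁻ φ in Ioo (-Real.pi) Real.pi, ENNReal.ofReal r *
        M.indicator 1 (r * Real.cos φ, r * Real.sin φ) := by
    intro r hr
    have hr0 : 0 < r := hA0.trans_lt hr.1
    have hrB : z ^ 2 + r ^ 2 < 1 := by nlinarith [hr.2]
    have hrA : z ^ 2 * (1 - s ^ 2) < s ^ 2 * r ^ 2 := by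
      have : A ^ 2 < r ^ 2 := by nlinarith [hr.1]
      rw [hA2, div_lt_iff₀ (by positivity)] at this
      linarith
    set q := κ * √(z ^ 2 + r ^ 2) / r with hq
    have hq0 : 0 < q := by have : 0 < z ^ 2 + r ^ 2 := by positivity
                           positivity
    have hqle : q ≤ κ / √(1 - s ^ 2) := by
      rw [hq, mul_div_assoc, div_eq_mul_inv κ]
      refine mul_le_mul_of_nonneg_left ?_ hκ.le
      rw [div_le_iff₀ hr0, ← Real.sqrt_inv, ← Real.sqrt_sq hr0.le, ← Real.sqrt_mul (inv_nonneg.2 (by linarith))]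
      refine Real.sqrt_le_sqrt ?_
      rw [Real.sqrt_sq hr0.le, inv_mul_eq_div, le_div_iff₀ (by linarith)]
      nlinarith
    have hq1 : κ / √(1 - s ^ 2) < 1 := by
      rw [div_lt_one (Real.sqrt_pos.2 (by linarith))]
      exact Real.lt_sqrt_of_sq_lt (by linarith)
    set ω := Real.arccos q with hωdef
    have hω0 : h < ω := h1.trans_le (Real.arccos_le_arccos hqle)
    have hωπ : ω < Real.pi / 2 := Real.arccos_lt_pi_div_two.2 hq0
    have hcos : κ * √(z ^ 2 + r ^ 2) = r * Real.cos ω := by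
      rw [hωdef, Real.cos_arccos (by linarith) (by linarith), hq]; field_simp
    have hsub : Ioo (ω - h) (ω + h) ∪ Ioo (-ω - h) (-ω + h) ⊆ Ioo (-Real.pi) Real.pi := by
      rintro φ (hφ | hφ) <;> constructor <;> linarith [hφ.1, hφ.2]
    have hvol : volume (Ioo (ω - h) (ω + h) ∪ Ioo (-ω - h) (-ω + h)) = ENNReal.ofReal (4 * h) := by
      rw [measure_union _ measurableSet_Ioo, Real.volume_Ioo, Real.volume_Ioo,
        ← ENNReal.ofReal_add (by linarith) (by linarith)]
      · congr 1; ring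
      · rw [Set.disjoint_left]; intro φ h1 h2; linarith [h1.1, h2.2]
    calc ENNReal.ofReal (r * (4 * h)) = ENNReal.ofReal r * ENNReal.ofReal (4 * h) :=
          ENNReal.ofReal_mul hr0.le
      _ = ∫⁻ φ in Ioo (ω - h) (ω + h) ∪ Ioo (-ω - h) (-ω + h), ENNReal.ofReal r := by
          rw [setLIntegral_const, hvol]
      _ ≤ ∫⁻ φ in Ioo (ω - h) (ω + h) ∪ Ioo (-ω - h) (-ω + h), ENNReal.ofReal r *
            M.indicator 1 (r * Real.cos φ, r * Real.sin φ) := by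
          refine setLIntegral_mono' (measurableSet_Ioo.union measurableSet_Ioo) fun φ hφ => ?_
          have : (r * Real.cos φ, r * Real.sin φ) ∈ M :=
            frame_polar_mem_lune b hr0 hrB hcos h0 hω0 (by linarith) hφ
          rw [indicator_of_mem this]; simp
      _ ≤ _ := lintegral_mono_set hsub
  calc ENNReal.ofReal (2 * h * (1 - z ^ 2 / s ^ 2))
      = ∫⁻ r in Ioo A B, ENNReal.ofReal (r * (4 * h)) := by
        rw [lintegral_annulus hA0 hAB (by linarith), hdiff]; congr 1; ring
    _ ≤ ∫⁻ r in Ioo A B, ∫⁻ φ in Ioo (-Real.pi) Real.pi, ENNReal.ofReal r *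
          M.indicator 1 (r * Real.cos φ, r * Real.sin φ) := setLIntegral_mono' measurableSet_Ioo hin
    _ ≤ ∫⁻ r in Ioi (0 : ℝ), ∫⁻ φ in Ioo (-Real.pi) Real.pi, ENNReal.ofReal r *
          M.indicator 1 (r * Real.cos φ, r * Real.sin φ) :=
        lintegral_mono_set fun r hr => hA0.trans_lt hr.1
    _ = ∫⁻ p in polarCoord.target, ENNReal.ofReal p.1 • M.indicator 1 (polarCoord.symm p) := by
        rw [polarCoord_target, Measure.volume_eq_prod, ← Measure.prod_restrict, lintegral_prod]
        · rfl
        · refine Measurable.aemeasurable ?_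
          refine (ENNReal.measurable_ofReal.comp measurable_fst).mul ?_
          exact (measurable_one.indicator hMm).comp continuous_polarCoord_symm.measurable
    _ = volume M := by
        rw [lintegral_comp_polarCoord_symm, lintegral_indicator_one hMm]

/-- The local Crofton estimate. Integrating the slice bound over `|z| < s` gives `2h · 4s/3`, and
`‖x - y‖ = 2 sin h ≤ 2h`. Keeping `s` strictly below the circle radius `√(1 - κ²)` makes the bound
uniform in `x` and `y`. -/
theorem exists_volume_lune_ge {κ s : ℝ} (hκ : 0 < κ) (hs : 0 < s) (hκs : κ ^ 2 + s ^ 2 < 1) :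
    ∃ δ > 0, ∀ x y : E3, ‖x‖ = 1 → ‖y‖ = 1 → ‖x - y‖ < δ →
      ENNReal.ofReal (4 / 3 * s * ‖x - y‖) ≤ volume (lune κ x y) := by
  have hs1 : s ^ 2 < 1 := by nlinarith
  set ω₀ := Real.arccos (κ / √(1 - s ^ 2)) with hω₀
  have hω₀0 : 0 < ω₀ := by
    rw [hω₀, Real.arccos_pos, div_lt_one (Real.sqrt_pos.2 (by linarith))]
    exact Real.lt_sqrt_of_sq_lt (by linarith)
  have hω₀1 : ω₀ < Real.pi / 2 := Real.arccos_lt_pi_div_two.2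
    (div_pos hκ (Real.sqrt_pos.2 (by linarith)))
  have hπ := Real.pi_pos
  -- The two terms ensure `h < ω₀` and `h < π / 4` for the half angle `h` between `x` and `y`.
  refine ⟨min (2 * Real.sin ω₀) (2 * Real.sin (Real.pi / 4)), lt_min
    (mul_pos two_pos (Real.sin_pos_of_pos_of_lt_pi hω₀0 (by linarith)))
    (mul_pos two_pos (Real.sin_pos_of_pos_of_lt_pi (by linarith) (by linarith))), ?_⟩
  intro x y hx hy hd
  rcases eq_or_ne x y with rfl | hxy
  · simp
  set d := ‖x - y‖ with hddef
  have hd0 : 0 < d := norm_pos_iff.2 (sub_ne_zero.2 hxy)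
  have hd1 := (lt_min_iff.1 hd).1
  have hd2 := (lt_min_iff.1 hd).2
  have hd3 : d < 2 := hd1.trans_le (by linarith [Real.sin_le_one ω₀])
  obtain ⟨b, hxb, hyb⟩ := exists_frame hx hy hxy hd3
  rw [← hddef] at hxb hyb
  set h := Real.arcsin (d / 2) with hh
  have hsin : Real.sin h = d / 2 := Real.sin_arcsin (by linarith) (by linarith)
  have h0 : 0 < h := Real.arcsin_pos.2 (by linarith)
  have h1 : h < ω₀ := (Real.arcsin_lt_iff_lt_sin' ⟨by linarith, by linarith⟩).2 (by linarith)
  have h4 : h < Real.pi / 4 := (Real.arcsin_lt_iff_lt_sin' ⟨by linarith, by linarith⟩).2 (by linarith)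
  have hdh : d / 2 ≤ h := hsin ▸ Real.sin_le h0.le
  rw [← hsin] at hxb hyb
  have hm := measurableSet_lune κ x y
  calc ENNReal.ofReal (4 / 3 * s * d)
      ≤ ENNReal.ofReal (∫ z in (-s)..s, 2 * h * (1 - z ^ 2 / s ^ 2)) := by
        refine ENNReal.ofReal_le_ofReal ?_
        have : ∫ z in (-s)..s, 2 * h * (1 - z ^ 2 / s ^ 2) = 2 * h * (4 / 3 * s) := by
          rw [intervalIntegral.integral_const_mul, intervalIntegral.integral_sub
            (by simp) (by apply Continuous.intervalIntegrable; fun_prop),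
            intervalIntegral.integral_div, integral_pow, intervalIntegral.integral_const]
          simp only [smul_eq_mul]
          norm_num
          field_simp
          left; ring
        rw [this]
        nlinarith
    _ = ∫⁻ z in Ioo (-s) s, ENNReal.ofReal (2 * h * (1 - z ^ 2 / s ^ 2)) := by
        rw [← ofReal_integral_eq_lintegral_ofReal]
        · rw [← integral_Ioc_eq_integral_Ioo, ← intervalIntegral.integral_of_le (by linarith)]
        · refine (Continuous.integrableOn_Icc (a := -s) (b := s) (by fun_prop)).mono_set
            Ioo_subset_Icc_self
        · refine (ae_restrict_mem measurableSet_Ioo).mono fun z hz => ?_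
          refine mul_nonneg (by linarith) (sub_nonneg.2 ((div_le_one (by positivity)).2 ?_))
          exact (sq_lt_sq' hz.1 hz.2).le
    _ ≤ ∫⁻ z in Ioo (-s) s, volume (Prod.mk z ⁻¹' (frame b ⁻¹' lune κ x y)) := by
        refine setLIntegral_mono' measurableSet_Ioo fun z hz => ?_
        rw [hxb, hyb]
        exact volume_slice_lune_ge b hκ hs hκs h0 h1 h4 hz
    _ ≤ ∫⁻ z, volume (Prod.mk z ⁻¹' (frame b ⁻¹' lune κ x y)) := setLIntegral_le_lintegral _ _
    _ = volume (frame b ⁻¹' lune κ x y) := by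
        exact (Measure.prod_apply (μ := volume) (ν := volume)
          ((measurePreserving_frame b).measurable hm)).symm
    _ = volume (lune κ x y) := (measurePreserving_frame b).measure_preimage hm.nullMeasurableSet

/-! ### Circular cones are null sets -/

/-- For `c < 1` the set lies in the frontier of a convex cone; for `c ≥ 1` equality in
Cauchy–Schwarz confines it to a line. -/
theorem volume_inner_eq_norm_of_nonneg {a : E3} (ha : ‖a‖ = 1) {c : ℝ} (hc : 0 ≤ c) :
    volume {x : E3 | inner ℝ a x = c * ‖x‖} = 0 := by
  rcases lt_or_ge c 1 with h1 | h1
  · set K : Set E3 := {x | c * ‖x‖ ≤ inner ℝ a x} with hK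
    have hconv : Convex ℝ K := by
      have h : ConvexOn ℝ univ (fun x : E3 => c * ‖x‖ - inner ℝ a x) :=
        ((convexOn_norm convex_univ).smul hc).sub
          ((innerSL ℝ a).toLinearMap.concaveOn convex_univ)
      have := h.convex_le 0
      convert this using 1
      ext x; simp [hK]
    refine measure_mono_null ?_ (hconv.addHaar_frontier volume)
    intro x hx
    have hx' : inner ℝ a x = c * ‖x‖ := hx
    rw [frontier_eq_closure_inter_closure]
    refine ⟨subset_closure hx'.ge, ?_⟩
    rw [Metric.mem_closure_iff]
    intro ε hε
    -- This move lowers the inner product by `ε / 2` but `c‖x‖` by at most `c ε / 2`, so it leaves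
    -- the cone.
    refine ⟨x - (ε / 2) • a, ?_, ?_⟩
    · simp only [hK, mem_compl_iff, mem_ofPred_eq, not_le, inner_sub_right, inner_smul_right,
        real_inner_self_eq_norm_sq, ha, hx']
      have h2 : ‖x‖ - ε / 2 ≤ ‖x - (ε / 2) • a‖ := by
        have := norm_sub_norm_le x ((ε / 2) • a)
        rwa [norm_smul, ha, mul_one, Real.norm_of_nonneg (by linarith)] at this
      nlinarith
    · rw [dist_eq_norm, sub_sub_cancel, norm_smul, ha, Real.norm_of_nonneg (by linarith)]
      linarith
  · have hne : Submodule.span ℝ {a} ≠ ⊤ := by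
      intro h
      have h2 := finrank_span_singleton (K := ℝ) (v := a) (by rintro rfl; simp at ha)
      rw [h, finrank_top, finrank_euclideanSpace_fin] at h2
      omega
    refine measure_mono_null ?_ (Measure.addHaar_submodule volume _ hne)
    intro x hx
    have hx' : inner ℝ a x = c * ‖x‖ := hx
    have h2 := real_inner_le_norm a x
    rw [ha, one_mul] at h2
    have h3 : inner ℝ a x = ‖a‖ * ‖x‖ := by
      rw [ha, one_mul]; exact le_antisymm h2 (by rw [hx']; nlinarith [norm_nonneg x])
    rw [inner_eq_norm_mul_iff_real, ha, one_smul] at h3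
    rw [SetLike.mem_coe, Submodule.mem_span_singleton]
    exact ⟨‖x‖, h3⟩

theorem volume_inner_eq_norm {a : E3} (ha : ‖a‖ = 1) (c : ℝ) :
    volume {x : E3 | inner ℝ a x = c * ‖x‖} = 0 := by
  rcases le_total 0 c with hc | hc
  · exact volume_inner_eq_norm_of_nonneg ha hc
  · have := volume_inner_eq_norm_of_nonneg (a := -a) (by simpa using ha) (c := -c) (by linarith)
    simpa [inner_neg_left] using this

/-! ### The upper bound for the length -/

theorem le_of_le_thickness {S : Set E3} {Θ : ℝ} (hS : ENNReal.ofReal Θ ≤ thickness S)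
    {p : Fin 3 → E3} (hp : Function.Injective p) (hpS : ∀ i, p i ∈ S) {q : E3} {r : ℝ}
    (h : ∀ i, dist (p i) q = r) : Θ ≤ r :=
  (ENNReal.ofReal_le_ofReal_iff (h 0 ▸ dist_nonneg)).1 (hS.trans (thickness_le_of_dist_eq hp hpS h))

theorem vec3_injective {α : Type*} {x y z : α} (h1 : x ≠ y) (h2 : x ≠ z) (h3 : y ≠ z) :
    Function.Injective ![x, y, z] := by
  intro i j hij
  fin_cases i <;> fin_cases j <;> simp_all

/-- A curve crosses the boundary of a cap between two points which the cap separates. -/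
theorem exists_crossing {γ : ℝ → E3} (hγ : Continuous γ) {κ u v : ℝ} (huv : u ≤ v) {c : E3}
    (hu : inner ℝ (γ u) c ≠ κ * ‖c‖) (hv : inner ℝ (γ v) c ≠ κ * ‖c‖)
    (hc : c ∈ lune κ (γ u) (γ v)) : ∃ τ ∈ Ioo u v, inner ℝ (γ τ) c = κ * ‖c‖ := by
  have hcont : ContinuousOn (fun t => inner ℝ (γ t) c) (Icc u v) := by fun_prop
  have hc2 := hc.2
  rcases lt_or_gt_of_ne hu with h1 | h1 <;> rcases lt_or_gt_of_ne hv with h2 | h2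
  · exact absurd ⟨fun h => absurd h h1.not_gt, fun h => absurd h h2.not_gt⟩ hc2
  · exact intermediate_value_Ioo huv hcont ⟨h1, h2⟩
  · exact intermediate_value_Ioo' huv hcont ⟨h2, h1⟩
  · exact absurd ⟨fun _ => h2, fun _ => h1⟩ hc2

/-- Each separated edge yields a crossing of the cap boundary on its arc of the curve. Three of them
would be three distinct points on a circle of radius less than `Θ`. -/
theorem card_crossings_le {γ : ℝ → E3} (hγ : IsClosedSphericalCurve γ) {Θ κ : ℝ}
    (hΘ : ENNReal.ofReal Θ ≤ thickness (Set.range γ)) (hκΘ : √(1 - κ ^ 2) < Θ)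
    {N : ℕ} {t : ℕ → ℝ} (ht : Monotone t) (h0 : t 0 = 0) (hN : t N = 2 * Real.pi) {c : E3}
    (hc : ∀ i, inner ℝ (γ (t i)) c ≠ κ * ‖c‖) :
    (∑ i ∈ Finset.range N, (lune κ (γ (t i)) (γ (t (i + 1)))).indicator (1 : E3 → ENNReal) c)
      ≤ (Metric.ball (0 : E3) 1).indicator (fun _ => 2) c := by
  classical
  by_cases hball : c ∈ Metric.ball (0 : E3) 1
  swap
  · rw [Finset.sum_eq_zero]
    · exact zero_le
    · intro i _
      exact indicator_of_notMem (fun h => hball h.1) _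
  rw [indicator_of_mem hball]
  have e : (∑ i ∈ Finset.range N,
      (lune κ (γ (t i)) (γ (t (i + 1)))).indicator (1 : E3 → ENNReal) c) =
      (((Finset.range N).filter fun i => c ∈ lune κ (γ (t i)) (γ (t (i + 1)))).card : ENNReal) := by
    simp [Set.indicator_apply]
  rw [e]
  suffices h : ((Finset.range N).filter fun i => c ∈ lune κ (γ (t i)) (γ (t (i + 1)))).card ≤ 2 by
    exact_mod_cast h
  by_contra! hcon
  obtain ⟨i, hi, j, hj, k, hk, hij, hik, hjk⟩ := Finset.two_lt_card.1 hcon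
  simp only [Finset.mem_filter, Finset.mem_range] at hi hj hk
  have hcont := hγ.contDiff.continuous
  have hcr : ∀ i, c ∈ lune κ (γ (t i)) (γ (t (i + 1))) →
      ∃ τ ∈ Ioo (t i) (t (i + 1)), inner ℝ (γ τ) c = κ * ‖c‖ := fun i hi =>
    exists_crossing hcont (ht i.le_succ) (hc i) (hc (i + 1)) hi
  obtain ⟨x, hx, hxc⟩ := hcr i hi.2
  obtain ⟨y, hy, hyc⟩ := hcr j hj.2
  obtain ⟨z, hz, hzc⟩ := hcr k hk.2
  -- The crossings lie in open parameter intervals, because no vertex is on the cap boundary.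
  -- Different edges therefore give different parameters in one period.
  have hne : ∀ {i j : ℕ} {x y : ℝ}, i < N → j < N → i ≠ j → x ∈ Ioo (t i) (t (i + 1)) →
      y ∈ Ioo (t j) (t (j + 1)) → γ x ≠ γ y := by
    intro i j x y hi hj hij hx hy hxy
    have hmem : ∀ {i : ℕ} {x : ℝ}, i < N → x ∈ Ioo (t i) (t (i + 1)) → x ∈ Ico 0 (2 * Real.pi) := by
      intro i x hi hx
      exact ⟨h0 ▸ (ht (Nat.zero_le i)).trans hx.1.le, hx.2.trans_le (hN ▸ ht hi)⟩
    have heq := hγ.simple (hmem hi hx) (hmem hj hy) hxy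
    subst heq
    rcases lt_or_gt_of_ne hij with h | h
    · linarith [ht (Nat.succ_le_of_lt h), hx.2, hy.1]
    · linarith [ht (Nat.succ_le_of_lt h), hy.2, hx.1]
  have hc0 : c ≠ 0 := by
    rintro rfl
    exact hi.2.2 (by simp)
  have hnorm : ∀ t, ‖γ t‖ = 1 := fun t => by simpa using hγ.mem_sphere t
  refine absurd (le_of_le_thickness hΘ (p := ![γ x, γ y, γ z])
    (vec3_injective (hne hi.1 hj.1 hij hx hy) (hne hi.1 hk.1 hik hx hz) (hne hj.1 hk.1 hjk hy hz))
    ?_ (q := (κ / ‖c‖) • c) (r := √(1 - κ ^ 2)) ?_) (not_le.2 hκΘ)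
  · intro i; fin_cases i <;> simp
  · intro i
    fin_cases i
    exacts [dist_smul_eq (hnorm _) hc0 hxc, dist_smul_eq (hnorm _) hc0 hyc,
      dist_smul_eq (hnorm _) hc0 hzc]

/-- Double counting of pairs of a centre and an edge that its circle separates: the lune volumes
bound their measure below, twice the ball volume bounds it above. -/
theorem sum_norm_sub_le {γ : ℝ → E3} (hγ : IsClosedSphericalCurve γ) {Θ κ s δ : ℝ} (hs : 0 < s)
    (hΘ : ENNReal.ofReal Θ ≤ thickness (Set.range γ)) (hκΘ : √(1 - κ ^ 2) < Θ)
    (hδ : ∀ x y : E3, ‖x‖ = 1 → ‖y‖ = 1 → ‖x - y‖ < δ →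
      ENNReal.ofReal (4 / 3 * s * ‖x - y‖) ≤ volume (lune κ x y))
    {N : ℕ} {t : ℕ → ℝ} (ht : Monotone t) (h0 : t 0 = 0) (hN : t N = 2 * Real.pi)
    (htδ : ∀ i < N, ‖γ (t i) - γ (t (i + 1))‖ < δ) :
    ∑ i ∈ Finset.range N, ‖γ (t i) - γ (t (i + 1))‖ ≤ 2 * Real.pi / s := by
  have hnorm : ∀ t, ‖γ t‖ = 1 := fun t => by simpa using hγ.mem_sphere t
  have hπ := Real.pi_pos
  have hae : ∀ᵐ c : E3, ∀ i, inner ℝ (γ (t i)) c ≠ κ * ‖c‖ := by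
    rw [ae_all_iff]
    intro i
    have := volume_inner_eq_norm (hnorm (t i)) κ
    rw [ae_iff]; simpa using this
  have key : ENNReal.ofReal (4 / 3 * s * ∑ i ∈ Finset.range N, ‖γ (t i) - γ (t (i + 1))‖) ≤
      ENNReal.ofReal (2 * (Real.pi * 4 / 3)) := by
    calc ENNReal.ofReal (4 / 3 * s * ∑ i ∈ Finset.range N, ‖γ (t i) - γ (t (i + 1))‖)
        = ∑ i ∈ Finset.range N, ENNReal.ofReal (4 / 3 * s * ‖γ (t i) - γ (t (i + 1))‖) := by
          rw [Finset.mul_sum, ENNReal.ofReal_sum_of_nonneg fun i _ => by positivity]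
      _ ≤ ∑ i ∈ Finset.range N, volume (lune κ (γ (t i)) (γ (t (i + 1)))) :=
          Finset.sum_le_sum fun i hi => hδ _ _ (hnorm _) (hnorm _) (htδ i (Finset.mem_range.1 hi))
      _ = ∑ i ∈ Finset.range N,
            ∫⁻ c, (lune κ (γ (t i)) (γ (t (i + 1)))).indicator (1 : E3 → ENNReal) c :=
          Finset.sum_congr rfl fun i _ => (lintegral_indicator_one (measurableSet_lune _ _ _)).symm
      _ = ∫⁻ c, ∑ i ∈ Finset.range N,
            (lune κ (γ (t i)) (γ (t (i + 1)))).indicator (1 : E3 → ENNReal) c :=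
          (lintegral_finsetSum _ fun i _ =>
            measurable_one.indicator (measurableSet_lune _ _ _)).symm
      _ ≤ ∫⁻ c, (Metric.ball (0 : E3) 1).indicator (fun _ => 2) c :=
          lintegral_mono_ae (hae.mono fun c hc => card_crossings_le hγ hΘ hκΘ ht h0 hN hc)
      _ = ENNReal.ofReal (2 * (Real.pi * 4 / 3)) := by
          rw [lintegral_indicator_const Metric.isOpen_ball.measurableSet,
            EuclideanSpace.volume_ball_fin_three, ENNReal.ofReal_mul two_pos.le]
          simp
  rw [ENNReal.ofReal_le_ofReal_iff (by positivity)] at key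
  rw [le_div_iff₀ hs]
  linarith

/-- Inscribed polygons approximate the length of a closed curve. -/
theorem exists_length_le_sum {γ : ℝ → E3} (hγ : ContDiff ℝ 1 γ) {ε δ : ℝ} (hε : 0 < ε)
    (hδ : 0 < δ) : ∃ (N : ℕ) (t : ℕ → ℝ), Monotone t ∧ t 0 = 0 ∧ t N = 2 * Real.pi ∧
      (∀ i < N, ‖γ (t i) - γ (t (i + 1))‖ < δ) ∧
      length γ ≤ (∑ i ∈ Finset.range N, ‖γ (t i) - γ (t (i + 1))‖) + ε := by
  have hπ := Real.pi_pos
  have hd : Continuous (deriv γ) := hγ.continuous_deriv le_rfl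
  -- Each piece loses at most `2ε'h`, and `N h = 2π`, so the total loss is `4π ε' = ε`.
  set ε' := ε / (4 * Real.pi) with hε'
  have hε'0 : 0 < ε' := by positivity
  have h1 := isCompact_Icc.uniformContinuousOn_of_continuous (s := Icc 0 (2 * Real.pi))
    hd.continuousOn
  have h2 := isCompact_Icc.uniformContinuousOn_of_continuous (s := Icc 0 (2 * Real.pi))
    hγ.continuous.continuousOn
  obtain ⟨η₁, hη₁, h1⟩ := Metric.uniformContinuousOn_iff.1 h1 ε' hε'0
  obtain ⟨η₂, hη₂, h2⟩ := Metric.uniformContinuousOn_iff.1 h2 δ hδ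
  obtain ⟨N, hN⟩ := exists_nat_gt (2 * Real.pi / min η₁ η₂)
  have hmin : 0 < min η₁ η₂ := lt_min hη₁ hη₂
  have hN0 : (0 : ℝ) < N := lt_trans (by positivity) hN
  set h := 2 * Real.pi / N with hh
  have hh0 : 0 < h := by positivity
  have hhη : h < min η₁ η₂ := by
    rw [hh, div_lt_iff₀ hN0]; rw [div_lt_iff₀ hmin] at hN; linarith
  set t : ℕ → ℝ := fun i => i * h with ht
  have hts : ∀ i, t (i + 1) = t i + h := fun i => by simp only [ht]; push_cast; ring
  have htm : Monotone t := monotone_nat_of_le_succ fun i => by rw [hts]; linarith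
  have ht0 : t 0 = 0 := by simp [ht]
  have htN : t N = 2 * Real.pi := by simp only [ht, hh]; field_simp
  have hmem : ∀ i < N, ∀ u ∈ Icc (t i) (t (i + 1)), u ∈ Icc 0 (2 * Real.pi) := fun i hi u hu =>
    ⟨ht0 ▸ (htm (Nat.zero_le i)).trans hu.1, htN ▸ hu.2.trans (htm hi)⟩
  have hdist : ∀ i, ∀ u ∈ Icc (t i) (t (i + 1)), dist u (t i) < min η₁ η₂ := fun i u hu => by
    rw [hts] at hu
    rw [Real.dist_eq, abs_of_nonneg (by linarith [hu.1])]; linarith [hu.2]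
  have hle : ∀ i, t i ≤ t (i + 1) := fun i => htm i.le_succ
  refine ⟨N, t, htm, ht0, htN, fun i hi => ?_, ?_⟩
  · rw [← dist_eq_norm, dist_comm]
    exact h2 _ (hmem i hi _ ⟨hle i, le_rfl⟩) _ (hmem i hi _ ⟨le_rfl, hle i⟩)
      ((hdist i _ ⟨hle i, le_rfl⟩).trans_le (min_le_right _ _))
  · have hpiece : ∀ i < N, ∫ u in (t i)..(t (i + 1)), ‖deriv γ u‖ ≤
        ‖γ (t i) - γ (t (i + 1))‖ + 2 * ε' * h := by
      intro i hi
      have hclose : ∀ u ∈ Icc (t i) (t (i + 1)), ‖deriv γ u - deriv γ (t i)‖ ≤ ε' := fun u hu => by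
        rw [← dist_eq_norm]
        exact (h1 _ (hmem i hi _ hu) _ (hmem i hi _ ⟨le_rfl, hle i⟩)
          ((hdist i _ hu).trans_le (min_le_left _ _))).le
      have e1 : ∫ u in (t i)..(t (i + 1)), ‖deriv γ u‖ ≤ h * (‖deriv γ (t i)‖ + ε') := by
        calc ∫ u in (t i)..(t (i + 1)), ‖deriv γ u‖
            ≤ ∫ u in (t i)..(t (i + 1)), (‖deriv γ (t i)‖ + ε') := by
              refine intervalIntegral.integral_mono_on (hle i)
                (hd.norm.intervalIntegrable _ _) (by simp) fun u hu => ?_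
              have := norm_le_norm_add_norm_sub' (deriv γ u) (deriv γ (t i))
              linarith [hclose u hu]
          _ = h * (‖deriv γ (t i)‖ + ε') := by
              rw [intervalIntegral.integral_const, hts]; simp
      have e2 : ‖(γ (t (i + 1)) - γ (t i)) - h • deriv γ (t i)‖ ≤ ε' * h := by
        have e3 : (γ (t (i + 1)) - γ (t i)) - h • deriv γ (t i) =
            ∫ u in (t i)..(t (i + 1)), (deriv γ u - deriv γ (t i)) := by
          rw [intervalIntegral.integral_sub (hd.intervalIntegrable _ _) (by simp),
            intervalIntegral.integral_const, intervalIntegral.integral_deriv_eq_sub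
              (fun u _ => (hγ.differentiable one_ne_zero) u) (hd.intervalIntegrable _ _), hts]
          simp
        rw [e3]
        have := intervalIntegral.norm_integral_le_of_norm_le_const (a := t i) (b := t (i + 1))
          (f := fun u => deriv γ u - deriv γ (t i)) (C := ε') (fun u hu => hclose u (by
            rw [uIoc_of_le (hle i)] at hu; exact Ioc_subset_Icc_self hu))
        rwa [hts, add_sub_cancel_left, abs_of_pos hh0, ← hts] at this
      have e4 : h * ‖deriv γ (t i)‖ ≤ ‖γ (t (i + 1)) - γ (t i)‖ + ε' * h := by
        have := norm_sub_norm_le (h • deriv γ (t i)) (γ (t (i + 1)) - γ (t i))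
        rw [norm_sub_rev (h • _), norm_smul, Real.norm_of_nonneg hh0.le] at this
        linarith
      rw [norm_sub_rev]
      linarith
    have hsum : length γ = ∑ i ∈ Finset.range N, ∫ u in (t i)..(t (i + 1)), ‖deriv γ u‖ := by
      rw [intervalIntegral.sum_integral_adjacent_intervals
        (fun i _ => hd.norm.intervalIntegrable _ _), ht0, htN, length]
    rw [hsum]
    calc _ ≤ ∑ i ∈ Finset.range N, (‖γ (t i) - γ (t (i + 1))‖ + 2 * ε' * h) :=
          Finset.sum_le_sum fun i hi => hpiece i (Finset.mem_range.1 hi)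
      _ = _ := by
          rw [Finset.sum_add_distrib, Finset.sum_const, Finset.card_range, nsmul_eq_mul, hh, hε']
          field_simp
          ring

theorem length_le_of_le_thickness {γ : ℝ → E3} (hγ : IsClosedSphericalCurve γ) {Θ : ℝ}
    (h0 : 0 < Θ) (h1 : Θ ≤ 1) (hΘ : ENNReal.ofReal Θ ≤ thickness (Set.range γ)) :
    length γ ≤ 2 * Real.pi / Θ := by
  have hs : ∀ s, 0 < s → s < Θ → length γ ≤ 2 * Real.pi / s := by
    intro s hs hsΘ
    -- The radius `m` of the test circles lies strictly between `s`, as the lune estimate needs, and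
    -- `Θ`, as the crossing count needs.
    set m := (s + Θ) / 2 with hm
    have hm0 : 0 < m := by linarith
    have hm1 : m < 1 := by linarith
    have hm2 : 0 < 1 - m ^ 2 := by nlinarith
    have hκ2 : √(1 - m ^ 2) ^ 2 = 1 - m ^ 2 := Real.sq_sqrt hm2.le
    obtain ⟨δ, hδ0, hδ⟩ := exists_volume_lune_ge (κ := √(1 - m ^ 2)) (Real.sqrt_pos.2 hm2) hs
      (by rw [hκ2]; nlinarith)
    refine le_of_forall_pos_le_add fun ε hε => ?_
    obtain ⟨N, t, htm, ht0, htN, htδ, hlen⟩ := exists_length_le_sum hγ.contDiff hε hδ0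
    refine hlen.trans (add_le_add_left (sum_norm_sub_le hγ hs hΘ ?_ hδ htm ht0 htN htδ) ε)
    rw [hκ2, sub_sub_cancel, Real.sqrt_sq hm0.le]
    linarith
  by_contra! hlt
  have hπ := Real.pi_pos
  have hL : 0 < length γ := lt_trans (by positivity) hlt
  have h2 : 2 * Real.pi / length γ < Θ := by
    rw [div_lt_iff₀ hL]; rw [div_lt_iff₀ h0] at hlt; linarith
  obtain ⟨s, hs1, hs2⟩ := exists_between h2
  have hs0 : 0 < s := lt_trans (by positivity) hs1
  have := hs s hs0 hs2
  rw [le_div_iff₀ hs0] at this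
  rw [div_lt_iff₀ hL] at hs1
  linarith

/-! ### Coordinates about a tilted axis and the levels of a stack -/

theorem inner_eq (p q : E3) : inner ℝ p q = p 0 * q 0 + p 1 * q 1 + p 2 * q 2 := by
  simp [PiLp.inner_apply, Fin.sum_univ_three]; ring

theorem norm_eq_one_iff {p : E3} : ‖p‖ = 1 ↔ p 0 ^ 2 + p 1 ^ 2 + p 2 ^ 2 = 1 := by
  rw [EuclideanSpace.norm_eq, Real.sqrt_eq_one]
  simp [Fin.sum_univ_three]

theorem ext_coord {p q : E3} (h0 : p 0 = q 0) (h1 : p 1 = q 1) (h2 : p 2 = q 2) : p = q := by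
  ext i; fin_cases i <;> assumption

theorem angle_eq_arccos {p q : E3} (hp : ‖p‖ = 1) (hq : ‖q‖ = 1) :
    InnerProductGeometry.angle p q = Real.arccos (inner ℝ p q) := by
  simp [InnerProductGeometry.angle, hp, hq]

/-- The coordinate along the axis `(sin α, 0, cos α)`. -/
noncomputable def height (α : ℝ) (p : E3) : ℝ := Real.sin α * p 0 + Real.cos α * p 2

/-- The coordinate along `(cos α, 0, -sin α)`. -/
noncomputable def horiz (α : ℝ) (p : E3) : ℝ := Real.cos α * p 0 - Real.sin α * p 2

/-- The point at the angle `φ` from the north pole on the great circle `y = 0`. -/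
noncomputable def axisPoint (φ : ℝ) : E3 := !₂[Real.sin φ, 0, Real.cos φ]

theorem norm_axisPoint (φ : ℝ) : ‖axisPoint φ‖ = 1 := by
  simp [norm_eq_one_iff, axisPoint]

theorem height_axisPoint (α φ : ℝ) : height α (axisPoint φ) = Real.cos (φ - α) := by
  simp [height, axisPoint, Real.cos_sub]; ring

theorem horiz_axisPoint (α φ : ℝ) : horiz α (axisPoint φ) = Real.sin (φ - α) := by
  simp [horiz, axisPoint, Real.sin_sub]; ring

theorem inner_axisPoint (α : ℝ) (p : E3) : inner ℝ (axisPoint α) p = height α p := by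
  rw [inner_eq]; simp [axisPoint, height]

theorem inner_eq_height_horiz (α : ℝ) (p q : E3) :
    inner ℝ p q = height α p * height α q + horiz α p * horiz α q + p 1 * q 1 := by
  rw [inner_eq, height, height, horiz, horiz]
  linear_combination -(p 0 * q 0 + p 2 * q 2) * Real.sin_sq_add_cos_sq α

theorem height_sq_add {p : E3} (hp : ‖p‖ = 1) (α : ℝ) :
    height α p ^ 2 + horiz α p ^ 2 + p 1 ^ 2 = 1 := by
  have := inner_eq_height_horiz α p p
  rw [real_inner_self_eq_norm_sq, hp] at this
  linarith

theorem ext_height {α : ℝ} {p q : E3} (h : height α p = height α q) (h' : horiz α p = horiz α q)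
    (h1 : p 1 = q 1) : p = q := by
  have e0 : ∀ p : E3, p 0 = Real.sin α * height α p + Real.cos α * horiz α p := fun p => by
    rw [height, horiz]; linear_combination -(p 0) * Real.sin_sq_add_cos_sq α
  have e2 : ∀ p : E3, p 2 = Real.cos α * height α p - Real.sin α * horiz α p := fun p => by
    rw [height, horiz]; linear_combination -(p 2) * Real.sin_sq_add_cos_sq α
  exact ext_coord (by rw [e0 p, e0 q, h, h']) h1 (by rw [e2 p, e2 q, h, h'])

theorem northPole_eq : northPole = axisPoint 0 := by simp [northPole, axisPoint]

theorem height_zero (p : E3) : height 0 p = p 2 := by simp [height]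

theorem theta_pos {n : ℕ} (hn : 1 ≤ n) : 0 < theta n := by
  have : (0 : ℝ) < n := by exact_mod_cast hn
  exact div_pos Real.pi_pos (by positivity)

theorem nat_mul_theta {n : ℕ} (hn : 1 ≤ n) : 2 * n * theta n = Real.pi := by
  have : (n : ℝ) ≠ 0 := by positivity
  rw [theta]; field_simp

theorem theta_le {n : ℕ} (hn : 1 ≤ n) : theta n ≤ Real.pi / 2 := by
  have := nat_mul_theta hn
  have h1 : (1 : ℝ) ≤ n := by exact_mod_cast hn
  nlinarith [theta_pos hn]

theorem odd_mul_theta_mem {n i : ℕ} (hi : i < n) :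
    (2 * i + 1) * theta n ∈ Icc (theta n) (Real.pi - theta n) := by
  have hn : 1 ≤ n := by omega
  have h := theta_pos hn
  have h1 := nat_mul_theta hn
  have h2 : (i : ℝ) + 1 ≤ n := by exact_mod_cast hi
  have h3 : (0 : ℝ) ≤ i := by positivity
  constructor <;> nlinarith

/-- The heights of the latitudinal circles. -/
def IsLevel (n : ℕ) (x : ℝ) : Prop := ∃ j : ℤ, x = Real.cos ((2 * j + 1) * theta n)

/-- Arbitrary integers in `IsLevel` make it visibly invariant under shifts of the angle; periodicity
and reflection of the cosine bring the index back to `0, …, n - 1`. -/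
theorem IsLevel.exists_lt {n : ℕ} (hn : 1 ≤ n) {x : ℝ} (hx : IsLevel n x) :
    ∃ i < n, x = Real.cos ((2 * i + 1) * theta n) := by
  obtain ⟨j, rfl⟩ := hx
  have hn' : (0 : ℤ) < 2 * n := by omega
  have h1 := Int.emod_nonneg j hn'.ne'
  have h2 := Int.emod_lt_of_pos j hn'
  have h3 := Int.mul_ediv_add_emod j (2 * n)
  have hπ := nat_mul_theta hn
  set r := j % (2 * n)
  set q := j / (2 * n)
  have hj : (j : ℝ) = 2 * n * q + r := by exact_mod_cast h3.symm
  have hc : Real.cos ((2 * j + 1) * theta n) = Real.cos ((2 * r + 1) * theta n) := by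
    rw [← Real.cos_add_int_mul_two_pi ((2 * r + 1) * theta n) q, hj, ← hπ]
    congr 1; ring
  rw [hc]
  rcases lt_or_ge r n with h | h
  · refine ⟨r.toNat, by omega, ?_⟩
    have : ((r.toNat : ℕ) : ℝ) = r := by exact_mod_cast Int.toNat_of_nonneg h1
    rw [this]
  -- The reflection of the angle `(2r + 1)ϑₙ` in `2π = 4nϑₙ`.
  · refine ⟨(2 * n - 1 - r).toNat, by omega, ?_⟩
    have : (((2 * n - 1 - r).toNat : ℕ) : ℝ) = 2 * n - 1 - r := by
      exact_mod_cast Int.toNat_of_nonneg (by omega : 0 ≤ 2 * (n : ℤ) - 1 - r)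
    rw [this, ← Real.cos_neg, ← Real.cos_add_two_pi (-_), ← hπ]
    congr 1; ring

theorem IsLevel.abs_le {n : ℕ} (hn : 1 ≤ n) {x : ℝ} (hx : IsLevel n x) :
    |x| ≤ Real.cos (theta n) := by
  obtain ⟨i, hi, rfl⟩ := hx.exists_lt hn
  have h := odd_mul_theta_mem hi
  have h0 := theta_pos hn
  rw [_root_.abs_le]
  constructor
  · rw [← Real.cos_pi_sub]
    exact Real.cos_le_cos_of_nonneg_of_le_pi (by linarith [h.1]) (by linarith) h.2
  · exact Real.cos_le_cos_of_nonneg_of_le_pi h0.le (by linarith [h.2]) h.1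

theorem mem_latitudeCircle {n i : ℕ} (hi : i < n) {p : E3} :
    p ∈ latitudeCircle n i ↔ ‖p‖ = 1 ∧ p 2 = Real.cos ((2 * i + 1) * theta n) := by
  have hmem := odd_mul_theta_mem hi
  have hθ := theta_pos (by omega : 1 ≤ n)
  have e : theta n + i * (2 * theta n) = (2 * i + 1) * theta n := by ring
  simp only [latitudeCircle, mem_ofPred_eq, mem_sphere_zero_iff_norm, e]
  refine and_congr_right fun hp => ?_
  rw [northPole_eq, angle_eq_arccos (norm_axisPoint 0) hp, inner_axisPoint, height_zero]
  have h2 : p 2 ^ 2 ≤ 1 := by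
    rw [norm_eq_one_iff] at hp; nlinarith [sq_nonneg (p 0), sq_nonneg (p 1)]
  constructor
  · intro h
    rw [← h, Real.cos_arccos (by nlinarith) (by nlinarith)]
  · intro h
    rw [h, Real.arccos_cos (by linarith [hmem.1]) (by linarith [hmem.2])]

theorem mem_stack {n : ℕ} (hn : 1 ≤ n) {p : E3} : p ∈ stack n ↔ ‖p‖ = 1 ∧ IsLevel n (p 2) := by
  simp only [stack, mem_iUnion, Finset.mem_range, exists_prop]
  constructor
  · rintro ⟨i, hi, hp⟩
    rw [mem_latitudeCircle hi] at hp
    exact ⟨hp.1, i, by exact_mod_cast hp.2⟩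
  · rintro ⟨h1, h2⟩
    obtain ⟨i, hi, h⟩ := h2.exists_lt hn
    exact ⟨i, hi, (mem_latitudeCircle hi).2 ⟨h1, h⟩⟩

theorem rotation_apply_zero (α : ℝ) (p : E3) :
    rotation α p 0 = Real.cos α * p 0 + Real.sin α * p 2 := rfl
theorem rotation_apply_one (α : ℝ) (p : E3) : rotation α p 1 = p 1 := rfl
theorem rotation_apply_two (α : ℝ) (p : E3) :
    rotation α p 2 = -Real.sin α * p 0 + Real.cos α * p 2 := rfl

theorem height_rotation (α : ℝ) (p : E3) : height α (rotation α p) = p 2 := by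
  rw [height, rotation_apply_zero, rotation_apply_two]
  linear_combination (p 2) * Real.sin_sq_add_cos_sq α

theorem horiz_rotation (α : ℝ) (p : E3) : horiz α (rotation α p) = p 0 := by
  rw [horiz, rotation_apply_zero, rotation_apply_two]
  linear_combination (p 0) * Real.sin_sq_add_cos_sq α

theorem norm_rotation (α : ℝ) {p : E3} : ‖rotation α p‖ = 1 ↔ ‖p‖ = 1 := by
  rw [norm_eq_one_iff, norm_eq_one_iff, rotation_apply_zero, rotation_apply_one, rotation_apply_two]
  have : (Real.cos α * p 0 + Real.sin α * p 2) ^ 2 + p 1 ^ 2 +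
      (-Real.sin α * p 0 + Real.cos α * p 2) ^ 2 = p 0 ^ 2 + p 1 ^ 2 + p 2 ^ 2 := by
    linear_combination (p 0 ^ 2 + p 2 ^ 2) * Real.sin_sq_add_cos_sq α
  rw [this]

theorem rotation_horiz_height (α : ℝ) (p : E3) :
    rotation α !₂[horiz α p, p 1, height α p] = p :=
  ext_height (α := α) (height_rotation _ _) (horiz_rotation _ _) rfl

/-- Two half stacks of circles: the western one about the axis at the angle `α`, the eastern one
about the axis at the angle `β`. -/
def doubleStack (n : ℕ) (α β : ℝ) : Set E3 :=
  {p | ‖p‖ = 1 ∧ (p 1 ≤ 0 ∧ IsLevel n (height α p) ∨ 0 ≤ p 1 ∧ IsLevel n (height β p))}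

theorem turnedStack_eq {n : ℕ} (hn : 1 ≤ n) (k : ℕ) :
    turnedStack n k = doubleStack n 0 (2 * k * theta n) := by
  ext p
  simp only [turnedStack, mem_union, mem_inter_iff, mem_stack hn, west, east, mem_ofPred_eq,
    mem_image, doubleStack, height_zero]
  constructor
  · rintro (⟨⟨h1, h2⟩, h3⟩ | ⟨q, ⟨⟨h1, h2⟩, h3⟩, rfl⟩)
    · exact ⟨h1, Or.inl ⟨h3, h2⟩⟩
    · exact ⟨(norm_rotation _).2 h1, Or.inr ⟨h3, by rwa [height_rotation]⟩⟩
  · rintro ⟨h1, ⟨h3, h2⟩ | ⟨h3, h2⟩⟩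
    · exact Or.inl ⟨⟨h1, h2⟩, h3⟩
    · refine Or.inr ⟨_, ⟨⟨?_, ?_⟩, ?_⟩, rotation_horiz_height (2 * k * theta n) p⟩
      · rwa [← norm_rotation (2 * k * theta n), rotation_horiz_height]
      · exact h2
      · exact h3

/-- Turning by an even multiple of `ϑₙ` permutes the odd multiples. This is why the half circles of
the two stacks share their end points on the seam. -/
theorem IsLevel.cos_add {n : ℕ} {r : ℝ} {j m : ℤ} (hr : r = (2 * j + 1) * theta n) :
    IsLevel n (Real.cos (2 * m * theta n + r)) ∧ IsLevel n (Real.cos (2 * m * theta n - r)) := by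
  constructor
  · exact ⟨m + j, by rw [hr]; push_cast; congr 1; ring⟩
  · exact ⟨j - m, by rw [hr, ← Real.cos_neg]; push_cast; congr 1; ring⟩

/-! ### The thickness of the turned stack -/

/-- A cap of radius less than `θ` meets only one circle of a stack. -/
theorem height_le_of_mem_cap {n : ℕ} (hn : 1 ≤ n) {α : ℝ} {c p q : E3} (hc : ‖c‖ = 1)
    (hp : ‖p‖ = 1) (hq : ‖q‖ = 1) (hpl : IsLevel n (height α p)) (hql : IsLevel n (height α q))
    (hpc : Real.cos (theta n) < inner ℝ p c) (hqc : Real.cos (theta n) < inner ℝ q c) :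
    height α q ≤ height α p := by
  have hθ := theta_pos hn
  have hθ' := theta_le hn
  have hang : ∀ p : E3, ‖p‖ = 1 → Real.cos (theta n) < inner ℝ p c →
      InnerProductGeometry.angle p c < theta n := fun p hp hpc => by
    rw [angle_eq_arccos hp hc, ← Real.arccos_cos hθ.le (by linarith)]
    have := real_inner_le_norm p c
    rw [hp, hc] at this
    exact Real.arccos_lt_arccos (Real.neg_one_le_cos _) hpc (by linarith)
  obtain ⟨i, hi, hi'⟩ := hpl.exists_lt hn
  obtain ⟨j, hj, hj'⟩ := hql.exists_lt hn
  have hmi := odd_mul_theta_mem hi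
  have hmj := odd_mul_theta_mem hj
  have e1 : InnerProductGeometry.angle (axisPoint α) p = (2 * i + 1) * theta n := by
    rw [angle_eq_arccos (norm_axisPoint α) hp, inner_axisPoint, hi',
      Real.arccos_cos (by linarith [hmi.1]) (by linarith [hmi.2])]
  have e2 : InnerProductGeometry.angle (axisPoint α) q = (2 * j + 1) * theta n := by
    rw [angle_eq_arccos (norm_axisPoint α) hq, inner_axisPoint, hj',
      Real.arccos_cos (by linarith [hmj.1]) (by linarith [hmj.2])]
  have t1 := InnerProductGeometry.angle_le_angle_add_angle (axisPoint α) q p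
  have t2 := InnerProductGeometry.angle_le_angle_add_angle q c p
  have t3 := hang p hp hpc
  have t4 := hang q hq hqc
  rw [InnerProductGeometry.angle_comm c p] at t2
  rw [e1, e2] at t1
  -- Both points are closer than `ϑₙ` to `c`, hence closer than `2ϑₙ` to each other, which is the
  -- spacing of the circles.
  have hij : (i : ℝ) < j + 1 := by nlinarith
  have hij' : i ≤ j := by
    have : i < j + 1 := by exact_mod_cast hij
    omega
  rw [hi', hj']
  refine Real.cos_le_cos_of_nonneg_of_le_pi (by linarith [hmi.1]) (by linarith [hmj.2]) ?_
  have : (i : ℝ) ≤ j := by exact_mod_cast hij'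
  nlinarith

theorem height_eq_of_mem_cap {n : ℕ} (hn : 1 ≤ n) {α : ℝ} {c p q : E3} (hc : ‖c‖ = 1)
    (hp : ‖p‖ = 1) (hq : ‖q‖ = 1) (hpl : IsLevel n (height α p)) (hql : IsLevel n (height α q))
    (hpc : Real.cos (theta n) < inner ℝ p c) (hqc : Real.cos (theta n) < inner ℝ q c) :
    height α p = height α q :=
  le_antisymm (height_le_of_mem_cap hn hc hq hp hql hpl hqc hpc)
    (height_le_of_mem_cap hn hc hp hq hpl hql hpc hqc)

/-- A line that meets a half circle twice does not separate the end points. -/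
theorem sq_le_sq_of_chord {A B D σ X₁ Y₁ X₂ Y₂ : ℝ} (h₁ : X₁ ^ 2 + Y₁ ^ 2 = σ ^ 2)
    (h₂ : X₂ ^ 2 + Y₂ ^ 2 = σ ^ 2) (hY₁ : Y₁ ≤ 0) (hY₂ : Y₂ ≤ 0) (l₁ : A + B * X₁ + D * Y₁ = 0)
    (l₂ : A + B * X₂ + D * Y₂ = 0) (hne : ¬ (X₁ = X₂ ∧ Y₁ = Y₂)) : (B * σ) ^ 2 ≤ A ^ 2 := by
  have hAB : A * (Y₂ - Y₁) = -B * (X₁ * Y₂ - X₂ * Y₁) := by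
    linear_combination Y₂ * l₁ - Y₁ * l₂
  -- For `Y₁ ≠ Y₂`, the chord extended to the diameter line `Y = 0` meets it at `(X₁Y₂ - X₂Y₁) / (Y₂
  -- - Y₁)`, which is not inside the disc.
  have hW : σ ^ 2 * (Y₂ - Y₁) ^ 2 ≤ (X₁ * Y₂ - X₂ * Y₁) ^ 2 := by
    have e : (X₁ * Y₂ - X₂ * Y₁) ^ 2 - σ ^ 2 * (Y₂ - Y₁) ^ 2 =
        Y₁ * Y₂ * ((X₁ - X₂) ^ 2 + (Y₁ - Y₂) ^ 2) := by
      linear_combination (Y₂ ^ 2 - Y₁ * Y₂) * h₁ + (Y₁ ^ 2 - Y₁ * Y₂) * h₂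
    have : 0 ≤ Y₁ * Y₂ * ((X₁ - X₂) ^ 2 + (Y₁ - Y₂) ^ 2) :=
      mul_nonneg (mul_nonneg_of_nonpos_of_nonpos hY₁ hY₂) (by positivity)
    linarith
  rcases eq_or_ne Y₁ Y₂ with hY | hY
  · subst hY
    have hX : X₁ ≠ X₂ := fun h => hne ⟨h, rfl⟩
    have hX' : X₁ - X₂ ≠ 0 := sub_ne_zero.2 hX
    have hB : B = 0 := by
      have : B * (X₁ - X₂) = 0 := by linear_combination l₁ - l₂
      exact (mul_eq_zero.1 this).resolve_right hX'
    rw [hB]; nlinarith [sq_nonneg A]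
  · have hpos : 0 < (Y₂ - Y₁) ^ 2 := by have := sub_ne_zero.2 (Ne.symm hY); positivity
    have h3 : A ^ 2 * (Y₂ - Y₁) ^ 2 = B ^ 2 * (X₁ * Y₂ - X₂ * Y₁) ^ 2 := by
      linear_combination (A * (Y₂ - Y₁) + -B * (X₁ * Y₂ - X₂ * Y₁)) * hAB
    have h4 : (B * σ) ^ 2 * (Y₂ - Y₁) ^ 2 ≤ A ^ 2 * (Y₂ - Y₁) ^ 2 := by
      rw [h3]; nlinarith [sq_nonneg B]
    exact le_of_mul_le_mul_right h4 hpos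

/-- The coordinate `u` along the line has the same square at all three points, so two of its values
coincide. The condition on `A` prevents the equation from being trivial. -/
theorem line_inter_circle {A B D σ : ℝ} (hA : A ≠ 0) {X Y : Fin 3 → ℝ}
    (h : ∀ i, X i ^ 2 + Y i ^ 2 = σ ^ 2) (l : ∀ i, A + B * X i + D * Y i = 0) :
    ∃ i j, i ≠ j ∧ X i = X j ∧ Y i = Y j := by
  by_contra! hne
  have hBD : 0 < B ^ 2 + D ^ 2 := by
    by_contra! hle
    have hB : B = 0 := by nlinarith [sq_nonneg B, sq_nonneg D]
    have hD : D = 0 := by nlinarith [sq_nonneg B, sq_nonneg D]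
    have := l 0
    rw [hB, hD] at this
    exact hA (by linarith)
  set u := fun i => B * Y i - D * X i with hu
  have hX : ∀ i, X i = (-A * B - D * u i) / (B ^ 2 + D ^ 2) := fun i => by
    rw [eq_div_iff hBD.ne']; simp only [hu]; linear_combination B * l i
  have hY : ∀ i, Y i = (-A * D + B * u i) / (B ^ 2 + D ^ 2) := fun i => by
    rw [eq_div_iff hBD.ne']; simp only [hu]; linear_combination D * l i
  have hsq : ∀ i, u i ^ 2 = (B ^ 2 + D ^ 2) * σ ^ 2 - A ^ 2 := fun i => by
    simp only [hu]
    linear_combination (B ^ 2 + D ^ 2) * h i + (A - B * X i - D * Y i) * l i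
  have hinj : ∀ i j, i ≠ j → u i ≠ u j := fun i j hij huij =>
    hne i j hij (by rw [hX, hX j, huij]) (by rw [hY, hY j, huij])
  have hneg : ∀ i j, i ≠ j → u i = - u j := fun i j hij =>
    (sq_eq_sq_iff_eq_or_eq_neg.1 ((hsq i).trans (hsq j).symm)).resolve_left (hinj i j hij)
  have h01 := hneg 0 1 (by decide)
  have h02 := hneg 0 2 (by decide)
  have h12 := hneg 1 2 (by decide)
  exact hinj 1 2 (by decide) (by linarith)

/-- On a level circle the cap boundary is the line `A + B X + D Y = 0`; this fixes the sign of `A`,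
because no level exceeds `cos ϑₙ` in absolute value. -/
theorem height_mul_sub_neg {n : ℕ} (hn : 1 ≤ n) {α x t : ℝ} (hx : IsLevel n x) {c : E3}
    (hc : ‖c‖ = 1) (ht : Real.cos (theta n) < t) : x * height α c - t < 0 := by
  have h1 := hx.abs_le hn
  have h2 : |height α c| ≤ 1 := by
    rw [← sq_le_one_iff_abs_le_one]
    nlinarith [height_sq_add hc α, sq_nonneg (horiz α c), sq_nonneg (c 1)]
  have h3 : x * height α c ≤ |x| * 1 := (le_abs_self _).trans
    ((abs_mul x _).trans_le (mul_le_mul_of_nonneg_left h2 (abs_nonneg _)))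
  linarith

/-- A cap boundary meets at most two points of one stack. -/
theorem stack_three_points {n : ℕ} (hn : 1 ≤ n) {α t : ℝ} {c : E3} (hc : ‖c‖ = 1)
    (ht : Real.cos (theta n) < t) {p : Fin 3 → E3} (hinj : Function.Injective p)
    (hp : ∀ i, ‖p i‖ = 1) (hl : ∀ i, IsLevel n (height α (p i)))
    (hpc : ∀ i, inner ℝ (p i) c = t) : False := by
  have heq : ∀ i, height α (p i) = height α (p 0) := fun i =>
    height_eq_of_mem_cap hn hc (hp i) (hp 0) (hl i) (hl 0) (by rwa [hpc]) (by rwa [hpc])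
  have hA := height_mul_sub_neg (α := α) hn (hl 0) hc ht
  obtain ⟨i, j, hij, hX, hY⟩ := line_inter_circle (B := horiz α c) (D := c 1)
    (σ := √(1 - height α (p 0) ^ 2)) hA.ne
    (X := fun i => horiz α (p i)) (Y := fun i => p i 1)
    (fun i => by
      have := height_sq_add (hp i) α
      rw [heq] at this
      rw [Real.sq_sqrt (by nlinarith [sq_nonneg (horiz α (p i)), sq_nonneg (p i 1)])]
      linarith)
    (fun i => by
      have := hpc i
      rw [inner_eq_height_horiz α, heq] at this
      linarith)
  exact hij (hinj (ext_height ((heq i).trans (heq j).symm) hX hY))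

/-- A cap boundary which meets one open half stack meets the opposite half stack at most once. -/
theorem half_stacks_three_points {n : ℕ} (hn : 1 ≤ n) {α β t ε : ℝ} (hε : ε ^ 2 = 1) {m : ℤ}
    (hαβ : β - α = 2 * m * theta n) {c p q e : E3} (hc : ‖c‖ = 1)
    (ht : Real.cos (theta n) < t) (hpq : p ≠ q) (hp : ‖p‖ = 1) (hq : ‖q‖ = 1) (he : ‖e‖ = 1)
    (hpw : ε * p 1 ≤ 0) (hqw : ε * q 1 ≤ 0) (hee : 0 < ε * e 1)
    (hpl : IsLevel n (height α p)) (hql : IsLevel n (height α q)) (hel : IsLevel n (height β e))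
    (hpc : inner ℝ p c = t) (hqc : inner ℝ q c = t) (hec : inner ℝ e c = t) : False := by
  have heq : height α p = height α q := height_eq_of_mem_cap hn hc hp hq hpl hql
    (by rwa [hpc]) (by rwa [hqc])
  have hA := height_mul_sub_neg (α := α) hn hpl hc ht
  set A := height α p * height α c - t
  set B := horiz α c with hB
  set σ := √(1 - height α p ^ 2)
  have hps := height_sq_add hp α
  have hqs := height_sq_add hq α
  have hσ : σ ^ 2 = 1 - height α p ^ 2 := Real.sq_sqrt (by
    nlinarith [sq_nonneg (horiz α p), sq_nonneg (p 1)])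
  rw [← heq] at hqs
  rw [inner_eq_height_horiz α] at hpc hqc
  rw [← heq] at hqc
  have l₁ : A + B * horiz α p + (ε * c 1) * (ε * p 1) = 0 := by
    linear_combination hpc + (c 1 * p 1) * hε
  have l₂ : A + B * horiz α q + (ε * c 1) * (ε * q 1) = 0 := by
    linear_combination hqc + (c 1 * q 1) * hε
  have s₁ : horiz α p ^ 2 + (ε * p 1) ^ 2 = σ ^ 2 := by
    rw [hσ]; linear_combination hps + (p 1) ^ 2 * hε
  have s₂ : horiz α q ^ 2 + (ε * q 1) ^ 2 = σ ^ 2 := by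
    rw [hσ]; linear_combination hqs + (q 1) ^ 2 * hε
  have hε0 : ε ≠ 0 := by rintro rfl; norm_num at hε
  have hne : ¬ (horiz α p = horiz α q ∧ ε * p 1 = ε * q 1) := fun h =>
    hpq (ext_height heq h.1 (mul_left_cancel₀ hε0 h.2))
  have hBσ := sq_le_sq_of_chord s₁ s₂ hpw hqw l₁ l₂ hne
  -- By the chord lemma and `A < 0`, neither end point of the half circle through `p` and `q` is
  -- inside the open cap, nor is any point of the diameter between them on the positive side of the
  -- line.
  have hBx : ∀ x, x ^ 2 ≤ σ ^ 2 → B * x ≤ -A := fun x hx => by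
    refine abs_le_of_sq_le_sq' ?_ (by linarith) |>.2
    have h2 := mul_le_mul_of_nonneg_left hx (sq_nonneg B)
    rw [mul_pow] at hBσ ⊢
    rw [neg_sq]
    exact h2.trans hBσ
  -- If the cap centre is not on the side of `p` and `q`, the line forces equality in `hBx` at both
  -- points, so they coincide. Otherwise the third point `e` puts an end point of its own arc inside
  -- the cap.
  rcases le_total 0 (ε * c 1) with h | h
  · have b₁ := hBx _ (by linarith [sq_nonneg (ε * p 1)] : horiz α p ^ 2 ≤ σ ^ 2)
    have b₂ := hBx _ (by linarith [sq_nonneg (ε * q 1)] : horiz α q ^ 2 ≤ σ ^ 2)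
    have c₁ := mul_nonpos_of_nonneg_of_nonpos h hpw
    have c₂ := mul_nonpos_of_nonneg_of_nonpos h hqw
    have d₁ : B * horiz α p = -A := by linarith
    have d₂ : B * horiz α q = -A := by linarith
    have hB0 : B ≠ 0 := by rintro h0; rw [h0] at d₁; linarith
    have hX : horiz α p = horiz α q := mul_left_cancel₀ hB0 (d₁.trans d₂.symm)
    refine hne ⟨hX, ?_⟩
    have hY : (ε * p 1) ^ 2 = (ε * q 1) ^ 2 := by rw [hX] at s₁; linarith
    rcases sq_eq_sq_iff_eq_or_eq_neg.1 hY with hY | hY <;> linarith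
  · have hA' := height_mul_sub_neg (α := β) hn hel hc ht
    obtain ⟨j, hj⟩ := hel
    set r := (2 * j + 1) * theta n with hr
    have hes := height_sq_add he β
    rw [inner_eq_height_horiz β] at hec
    rw [hj] at hec hes hA'
    -- As `e` is off the seam, its horizontal coordinate is strictly between those of the ends of
    -- its arc.
    have hXs : horiz β e ^ 2 < Real.sin r ^ 2 := by
      have : 0 < (ε * e 1) ^ 2 := by positivity
      rw [mul_pow, hε, one_mul] at this
      nlinarith [Real.sin_sq_add_cos_sq r]
    have hBX : -(Real.cos r * height β c - t) ≤ horiz β c * horiz β e := by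
      have : e 1 * c 1 ≤ 0 := by
        have h5 : (ε * e 1) * (ε * c 1) ≤ 0 := mul_nonpos_of_nonneg_of_nonpos hee.le h
        calc e 1 * c 1 = (ε * e 1) * (ε * c 1) := by linear_combination -(e 1 * c 1) * hε
          _ ≤ 0 := h5
      linarith
    have hB0 : horiz β c ≠ 0 := by rintro h0; rw [h0] at hBX; linarith
    have hlt : horiz β c * horiz β e < |horiz β c * Real.sin r| := by
      rw [abs_mul]
      refine (le_abs_self _).trans_lt ?_
      rw [abs_mul]
      exact mul_lt_mul_of_pos_left (sq_lt_sq.1 hXs) (abs_pos.2 hB0)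
    -- the end point of the arc through `e` lies in the cap
    have hb : ∃ φ, IsLevel n (height α (axisPoint φ)) ∧ t < inner ℝ (axisPoint φ) c := by
      have hl := IsLevel.cos_add (n := n) (m := m) hr
      rcases abs_cases (horiz β c * Real.sin r) with ⟨h6, -⟩ | ⟨h6, -⟩
      · refine ⟨β + r, ?_, ?_⟩
        · rw [height_axisPoint, show β + r - α = 2 * m * theta n + r by rw [← hαβ]; ring]
          exact hl.1
        · rw [inner_eq_height_horiz β, height_axisPoint, horiz_axisPoint, add_sub_cancel_left]
          simp only [axisPoint]
          simp
          linarith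
      · refine ⟨β - r, ?_, ?_⟩
        · rw [height_axisPoint, show β - r - α = 2 * m * theta n - r by rw [← hαβ]; ring]
          exact hl.2
        · rw [inner_eq_height_horiz β, height_axisPoint, horiz_axisPoint, sub_sub_cancel_left,
            Real.cos_neg, Real.sin_neg]
          simp only [axisPoint]
          simp
          linarith
    obtain ⟨φ, hφl, hφ⟩ := hb
    -- That end point also belongs to the first stack, so the cap forces it onto the circle of `p`
    -- and `q`, where `hBx` excludes it.
    have hbeq : height α (axisPoint φ) = height α p :=
      height_eq_of_mem_cap hn hc (norm_axisPoint φ) hp hφl hpl (ht.trans hφ)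
        (by rw [inner_eq_height_horiz α, hpc]; exact ht)
    have hbs := height_sq_add (norm_axisPoint φ) α
    have hb1 : axisPoint φ 1 = 0 := by simp [axisPoint]
    rw [inner_eq_height_horiz α, hbeq, hb1] at hφ
    rw [hbeq, hb1] at hbs
    have := hBx (horiz α (axisPoint φ)) (by rw [hσ]; linarith)
    linarith

theorem isLevel_height_of_apply_one_eq_zero {n : ℕ} {α β : ℝ} {m : ℤ}
    (hαβ : β - α = 2 * m * theta n) {p : E3} (hp : ‖p‖ = 1) (h1 : p 1 = 0)
    (hl : IsLevel n (height β p)) : IsLevel n (height α p) := by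
  obtain ⟨j, hj⟩ := hl
  set r := (2 * j + 1) * theta n with hr
  have hs := height_sq_add hp β
  rw [h1, hj] at hs
  have hsin : horiz β p ^ 2 = Real.sin r ^ 2 := by linarith [Real.sin_sq_add_cos_sq r]
  have hl := IsLevel.cos_add (n := n) (m := m) hr
  rcases sq_eq_sq_iff_eq_or_eq_neg.1 hsin with h | h
  · have : p = axisPoint (β + r) := ext_height (α := β)
      (by rw [hj, height_axisPoint, add_sub_cancel_left])
      (by rw [h, horiz_axisPoint, add_sub_cancel_left]) (by simp [axisPoint, h1])
    rw [this, height_axisPoint, show β + r - α = 2 * m * theta n + r by rw [← hαβ]; ring]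
    exact hl.1
  · have : p = axisPoint (β - r) := ext_height (α := β)
      (by rw [hj, height_axisPoint, sub_sub_cancel_left, Real.cos_neg])
      (by rw [h, horiz_axisPoint, sub_sub_cancel_left, Real.sin_neg]) (by simp [axisPoint, h1])
    rw [this, height_axisPoint, show β - r - α = 2 * m * theta n - r by rw [← hαβ]; ring]
    exact hl.2

/-- Seam points lie on both stacks. Hence either all three points lie on one stack, or two lie on
one closed half and the third strictly on the other side. -/
theorem doubleStack_three_points {n : ℕ} (hn : 1 ≤ n) {α β t : ℝ} {m : ℤ}
    (hαβ : β - α = 2 * m * theta n) {c x y z : E3} (hc : ‖c‖ = 1)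
    (ht : Real.cos (theta n) < t) (hxy : x ≠ y) (hxz : x ≠ z) (hyz : y ≠ z)
    (hx : x ∈ doubleStack n α β) (hy : y ∈ doubleStack n α β) (hz : z ∈ doubleStack n α β)
    (hxc : inner ℝ x c = t) (hyc : inner ℝ y c = t) (hzc : inner ℝ z c = t) : False := by
  have hβα : α - β = 2 * (-m : ℤ) * theta n := by push_cast; linarith
  have hside : ∀ p ∈ doubleStack n α β, (p 1 < 0 ∧ IsLevel n (height α p)) ∨
      (0 < p 1 ∧ IsLevel n (height β p)) ∨
      (p 1 = 0 ∧ IsLevel n (height α p) ∧ IsLevel n (height β p)) := by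
    rintro p ⟨hp, ⟨h1, h2⟩ | ⟨h1, h2⟩⟩
    · rcases h1.lt_or_eq with h | h
      · exact Or.inl ⟨h, h2⟩
      · exact Or.inr (Or.inr ⟨h, h2, isLevel_height_of_apply_one_eq_zero hβα hp h h2⟩)
    · rcases h1.lt_or_eq with h | h
      · exact Or.inr (Or.inl ⟨h, h2⟩)
      · exact Or.inr (Or.inr ⟨h.symm, isLevel_height_of_apply_one_eq_zero hαβ hp h.symm h2, h2⟩)
  have three : ∀ γ, IsLevel n (height γ x) → IsLevel n (height γ y) → IsLevel n (height γ z) →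
      False := fun γ h1 h2 h3 =>
    stack_three_points (p := ![x, y, z]) (α := γ) hn hc ht (vec3_injective hxy hxz hyz)
      (by intro i; fin_cases i; exacts [hx.1, hy.1, hz.1])
      (by intro i; fin_cases i; exacts [h1, h2, h3])
      (by intro i; fin_cases i; exacts [hxc, hyc, hzc])
  have west : ∀ p q e : E3, p ≠ q → p ∈ doubleStack n α β → q ∈ doubleStack n α β →
      e ∈ doubleStack n α β → inner ℝ p c = t → inner ℝ q c = t → inner ℝ e c = t →
      p 1 ≤ 0 → q 1 ≤ 0 → 0 < e 1 → IsLevel n (height α p) → IsLevel n (height α q) →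
      IsLevel n (height β e) → False := fun p q e hpq hp hq he hpc hqc hec h1 h2 h3 h4 h5 h6 =>
    half_stacks_three_points hn (ε := 1) (by norm_num) hαβ hc ht hpq hp.1 hq.1 he.1
      (by linarith) (by linarith) (by linarith) h4 h5 h6 hpc hqc hec
  have east : ∀ p q e : E3, p ≠ q → p ∈ doubleStack n α β → q ∈ doubleStack n α β →
      e ∈ doubleStack n α β → inner ℝ p c = t → inner ℝ q c = t → inner ℝ e c = t →
      0 ≤ p 1 → 0 ≤ q 1 → e 1 < 0 → IsLevel n (height β p) → IsLevel n (height β q) →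
      IsLevel n (height α e) → False := fun p q e hpq hp hq he hpc hqc hec h1 h2 h3 h4 h5 h6 =>
    half_stacks_three_points hn (ε := -1) (by norm_num) hβα hc ht hpq hp.1 hq.1 he.1
      (by linarith) (by linarith) (by linarith) h4 h5 h6 hpc hqc hec
  have wxy := west x y z hxy hx hy hz hxc hyc hzc
  have wxz := west x z y hxz hx hz hy hxc hzc hyc
  have wyz := west y z x hyz hy hz hx hyc hzc hxc
  have exy := east x y z hxy hx hy hz hxc hyc hzc
  have exz := east x z y hxz hx hz hy hxc hzc hyc
  have eyz := east y z x hyz hy hz hx hyc hzc hxc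
  have tα := three α
  have tβ := three β
  rcases hside x hx with ⟨x1, x2⟩ | ⟨x1, x2⟩ | ⟨x1, x2, x3⟩ <;>
  rcases hside y hy with ⟨y1, y2⟩ | ⟨y1, y2⟩ | ⟨y1, y2, y3⟩ <;>
  rcases hside z hz with ⟨z1, z2⟩ | ⟨z1, z2⟩ | ⟨z1, z2, z3⟩ <;>
  first
  | exact tα ‹_› ‹_› ‹_›
  | exact tβ ‹_› ‹_› ‹_›
  | exact wxy (by linarith) (by linarith) ‹_› ‹_› ‹_› ‹_›
  | exact wxz (by linarith) (by linarith) ‹_› ‹_› ‹_› ‹_›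
  | exact wyz (by linarith) (by linarith) ‹_› ‹_› ‹_› ‹_›
  | exact exy (by linarith) (by linarith) ‹_› ‹_› ‹_› ‹_›
  | exact exz (by linarith) (by linarith) ‹_› ‹_› ‹_› ‹_›
  | exact eyz (by linarith) (by linarith) ‹_› ‹_› ‹_› ‹_›

theorem sin_theta_pos {n : ℕ} (hn : 1 ≤ n) : 0 < Real.sin (theta n) :=
  Real.sin_pos_of_pos_of_lt_pi (theta_pos hn) (by linarith [theta_le hn, Real.pi_pos])

theorem cos_theta_nonneg {n : ℕ} (hn : 1 ≤ n) : 0 ≤ Real.cos (theta n) :=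
  Real.cos_nonneg_of_neg_pi_div_two_le_of_le (by linarith [theta_pos hn, Real.pi_pos]) (theta_le hn)

/-- A circumradius `R < sin ϑₙ` places the circumcentre at distance `√(1 - R²) > cos ϑₙ` from the
origin, so the circumcircle bounds a cap of angular radius less than `ϑₙ` about its direction. -/
theorem le_thickness_doubleStack {n : ℕ} (hn : 1 ≤ n) {α β : ℝ} {m : ℤ}
    (hαβ : β - α = 2 * m * theta n) :
    ENNReal.ofReal (Real.sin (theta n)) ≤ thickness (doubleStack n α β) := by
  refine le_iInf₂ fun T hT => ENNReal.ofReal_le_ofReal ?_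
  by_contra! hlt
  have hnorm : ∀ i, dist (T.points i) 0 = 1 := fun i => by rw [dist_zero_right]; exact (hT i).1
  have h1 := T.dist_circumcenter_sq_eq_sq_sub_circumradius hnorm
    (T.orthogonalProjection_eq_circumcenter_of_dist_eq hnorm)
    (subset_affineSpan ℝ _ (Set.mem_range_self 0))
  have hR := T.circumradius_nonneg
  set O := T.circumcenter
  set R := T.circumradius
  rw [dist_zero_left] at h1
  have hsc := Real.sin_sq_add_cos_sq (theta n)
  have hOsq : Real.cos (theta n) ^ 2 < ‖O‖ ^ 2 := by rw [sq ‖O‖, h1]; nlinarith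
  have hO : Real.cos (theta n) < ‖O‖ := lt_of_pow_lt_pow_left₀ 2 (norm_nonneg _) hOsq
  have hO0 : 0 < ‖O‖ := (cos_theta_nonneg hn).trans_lt hO
  have hinner : ∀ i, inner ℝ (T.points i) (‖O‖⁻¹ • O) = ‖O‖ := fun i => by
    have h2 : dist (T.points i) O = R := T.dist_circumcenter_eq_circumradius i
    have h3 := norm_sub_sq_real (T.points i) O
    rw [← dist_eq_norm, h2, (hT i).1] at h3
    rw [inner_smul_right, inv_mul_eq_div, div_eq_iff hO0.ne']
    linarith
  have hT' := T.independent.injective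
  exact doubleStack_three_points hn hαβ (c := ‖O‖⁻¹ • O)
    (by rw [norm_smul, norm_inv, norm_norm, inv_mul_cancel₀ hO0.ne']) hO
    (hT'.ne (by decide : (0 : Fin 3) ≠ 1)) (hT'.ne (by decide : (0 : Fin 3) ≠ 2))
    (hT'.ne (by decide : (1 : Fin 3) ≠ 2)) (hT 0) (hT 1) (hT 2)
    (hinner 0) (hinner 1) (hinner 2)

theorem thickness_turnedStack {n : ℕ} (hn : 1 ≤ n) (k : ℕ) :
    thickness (turnedStack n k) = ENNReal.ofReal (Real.sin (theta n)) := by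
  rw [turnedStack_eq hn]
  refine le_antisymm ?_ (le_thickness_doubleStack hn (m := k) (by push_cast; ring))
  have hs := sin_theta_pos hn
  have hmem : ∀ x y : ℝ, x ^ 2 + y ^ 2 = Real.sin (theta n) ^ 2 → y ≤ 0 →
      !₂[x, y, Real.cos (theta n)] ∈ doubleStack n 0 (2 * k * theta n) := fun x y hxy hy => by
    refine ⟨?_, Or.inl ⟨hy, 0, ?_⟩⟩
    · rw [norm_eq_one_iff]
      change x ^ 2 + y ^ 2 + Real.cos (theta n) ^ 2 = 1
      rw [hxy, Real.sin_sq_add_cos_sq]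
    · rw [height_zero]; simp
  have hdist : ∀ x y : ℝ, x ^ 2 + y ^ 2 = Real.sin (theta n) ^ 2 →
      dist (!₂[x, y, Real.cos (theta n)] : E3) !₂[0, 0, Real.cos (theta n)] =
        Real.sin (theta n) := fun x y hxy => by
    rw [EuclideanSpace.dist_eq]
    simp only [Fin.sum_univ_three, Real.dist_eq, sq_abs]
    simp [hxy, Real.sqrt_sq hs.le]
  set s := Real.sin (theta n)
  have hne : ∀ x y x' y' : ℝ, x ≠ x' → (!₂[x, y, Real.cos (theta n)] : E3) ≠
      !₂[x', y', Real.cos (theta n)] := fun x y x' y' h h' => h (congrArg (fun p : E3 => p 0) h')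
  -- The value is attained on the untouched western half of `C₀`: its two end points and its
  -- midpoint.
  refine thickness_le_of_dist_eq (q := !₂[0, 0, Real.cos (theta n)])
    (p := ![!₂[s, 0, Real.cos (theta n)], !₂[0, -s, Real.cos (theta n)],
      !₂[-s, 0, Real.cos (theta n)]])
    (vec3_injective (hne _ _ _ _ hs.ne') (hne _ _ _ _ (by linarith)) (hne _ _ _ _ (by linarith)))
    ?_ ?_
  · intro i
    fin_cases i
    exacts [hmem _ _ (by ring) le_rfl, hmem _ _ (by ring) (by linarith), hmem _ _ (by ring) le_rfl]
  · intro i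
    fin_cases i
    exacts [hdist _ _ (by ring), hdist _ _ (by ring), hdist _ _ (by ring)]

/-! ### Sphere filling -/

theorem toSphere_inner_eq {a : E3} (ha : ‖a‖ = 1) (c : ℝ) :
    (volume : Measure E3).toSphere {ξ : Metric.sphere (0 : E3) 1 | inner ℝ a (ξ : E3) = c} = 0 := by
  have hm : MeasurableSet {ξ : Metric.sphere (0 : E3) 1 | inner ℝ a (ξ : E3) = c} :=
    (isClosed_eq (by fun_prop) continuous_const).measurableSet
  rw [Measure.toSphere_apply' _ hm, measure_mono_null ?_ (volume_inner_eq_norm ha c), mul_zero]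
  rintro _ ⟨r, hr, _, ⟨ξ, hξ, rfl⟩, rfl⟩
  have hξ' : inner ℝ a (ξ : E3) = c := hξ
  have hξn : ‖(ξ : E3)‖ = 1 := by simp
  simp only [mem_ofPred_eq, inner_smul_right, norm_smul, hξ', hξn,
    Real.norm_of_nonneg hr.1.le]
  ring

theorem toSphere_univ : (volume : Measure E3).toSphere univ = ENNReal.ofReal (4 * Real.pi) := by
  rw [Measure.toSphere_apply_univ, EuclideanSpace.volume_ball_fin_three, finrank_euclideanSpace_fin]
  simp only [ENNReal.ofReal_one, one_pow, one_mul]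
  rw [show ((3 : ℕ) : ENNReal) = ENNReal.ofReal 3 by simp, ← ENNReal.ofReal_mul (by norm_num)]
  congr 1; ring

/-- A point off the midway circles is closer than `θ` to a point of a stack, which lies on the
same meridian. -/
theorem exists_mem_stack_angle_lt {n : ℕ} (hn : 1 ≤ n) (α : ℝ) {ξ : E3} (hξ : ‖ξ‖ = 1)
    (hne : ∀ i : ℕ, i ≤ n → height α ξ ≠ Real.cos (2 * i * theta n)) :
    ∃ p : E3, ‖p‖ = 1 ∧ IsLevel n (height α p) ∧ (∃ l : ℝ, 0 ≤ l ∧ p 1 = l * ξ 1) ∧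
      InnerProductGeometry.angle p ξ < theta n := by
  have hθ := theta_pos hn
  have hπ := nat_mul_theta hn
  have hs := height_sq_add hξ α
  have hh : height α ξ ^ 2 ≤ 1 := by nlinarith [sq_nonneg (horiz α ξ), sq_nonneg (ξ 1)]
  obtain ⟨hm1, h1⟩ := abs_le.1 ((sq_le_one_iff_abs_le_one _).1 hh)
  set ψ := Real.arccos (height α ξ) with hψ
  have hcos : Real.cos ψ = height α ξ := Real.cos_arccos hm1 h1
  have hψ0 : 0 ≤ ψ := Real.arccos_nonneg _
  have hψπ : ψ ≤ Real.pi := Real.arccos_le_pi _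
  have hψne : ∀ i : ℕ, i ≤ n → ψ ≠ 2 * i * theta n := fun i hi h => hne i hi (by rw [← h, hcos])
  have hψ0' : 0 < ψ := lt_of_le_of_ne hψ0 fun h => hψne 0 (Nat.zero_le _) (by simp [← h])
  have hψπ' : ψ < Real.pi := lt_of_le_of_ne hψπ fun h => hψne n le_rfl (by rw [h, hπ])
  -- The index of the band of width `2ϑₙ` that contains the colatitude `ψ`; the circle `Cᵢ` is its
  -- midline.
  set i := ⌊ψ / (2 * theta n)⌋₊ with hi
  have hfl := Nat.floor_le (a := ψ / (2 * theta n)) (by positivity)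
  have hfl' := Nat.lt_floor_add_one (ψ / (2 * theta n))
  rw [← hi, le_div_iff₀ (by positivity)] at hfl
  rw [← hi, div_lt_iff₀ (by positivity)] at hfl'
  have hin : i < n := by
    by_contra! h
    have : (n : ℝ) ≤ i := by exact_mod_cast h
    nlinarith
  have hlo : 2 * i * theta n < ψ := lt_of_le_of_ne (by linarith) (hψne i hin.le).symm
  set χ := (2 * i + 1) * theta n with hχ
  have hχmem := odd_mul_theta_mem hin
  have hsin : 0 < Real.sin ψ := Real.sin_pos_of_pos_of_lt_pi hψ0' hψπ'
  have hsin' : 0 ≤ Real.sin χ :=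
    Real.sin_nonneg_of_nonneg_of_le_pi (by linarith [hχmem.1]) (by linarith [hχmem.2])
  -- Scaling both horizontal coordinates by `l ≥ 0` moves along the meridian to colatitude `χ` and
  -- does not change the side of the seam.
  set l := Real.sin χ / Real.sin ψ with hl
  have hlψ : l * Real.sin ψ = Real.sin χ := div_mul_cancel₀ _ hsin.ne'
  have hrest : horiz α ξ ^ 2 + ξ 1 ^ 2 = Real.sin ψ ^ 2 := by
    rw [Real.sin_sq, hcos]; linarith
  set v : E3 := !₂[l * horiz α ξ, l * ξ 1, Real.cos χ] with hv
  have hp : ‖rotation α v‖ = 1 := by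
    rw [norm_rotation, norm_eq_one_iff]
    change (l * horiz α ξ) ^ 2 + (l * ξ 1) ^ 2 + Real.cos χ ^ 2 = 1
    linear_combination l ^ 2 * hrest + (l * Real.sin ψ + Real.sin χ) * hlψ +
      Real.sin_sq_add_cos_sq χ
  refine ⟨rotation α v, hp, ⟨i, ?_⟩, ⟨l, div_nonneg hsin' hsin.le, rfl⟩, ?_⟩
  · rw [height_rotation]; rfl
  · have hin : inner ℝ (rotation α v) ξ = Real.cos |χ - ψ| := by
      rw [inner_eq_height_horiz α, height_rotation, horiz_rotation, rotation_apply_one, ← hcos,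
        Real.cos_abs, Real.cos_sub]
      change Real.cos χ * Real.cos ψ + l * horiz α ξ * horiz α ξ + l * ξ 1 * ξ 1 = _
      linear_combination l * hrest + Real.sin ψ * hlψ
    have hd : |χ - ψ| < theta n := abs_lt.2 ⟨by linarith, by linarith⟩
    rw [angle_eq_arccos hp hξ, hin, Real.arccos_cos (abs_nonneg _) (by linarith [theta_le hn])]
    exact hd

theorem isSphereFilling_doubleStack {n : ℕ} (hn : 1 ≤ n) (α β : ℝ) :
    IsSphereFilling (theta n) (doubleStack n α β) := by
  have hae : ∀ α : ℝ, ∀ᵐ ξ : Metric.sphere (0 : E3) 1 ∂(volume : Measure E3).toSphere,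
      ∀ i : ℕ, height α (ξ : E3) ≠ Real.cos (2 * i * theta n) := fun α => by
    rw [ae_all_iff]
    intro i
    rw [ae_iff]
    simpa [inner_axisPoint] using
      toSphere_inner_eq (norm_axisPoint α) (Real.cos (2 * i * theta n))
  rw [IsSphereFilling, area, ← toSphere_univ]
  refine measure_congr (Filter.eventuallyEq_univ.2 ?_)
  filter_upwards [hae α, hae β] with ξ hα hβ
  have hξ : ‖(ξ : E3)‖ = 1 := by simp
  rcases le_total ((ξ : E3) 1) 0 with h | h
  · obtain ⟨p, hp, hl, ⟨l, hl0, hp1⟩, hang⟩ := exists_mem_stack_angle_lt hn α hξ fun i _ => hα i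
    exact ⟨p, ⟨hp, Or.inl ⟨hp1 ▸ mul_nonpos_of_nonneg_of_nonpos hl0 h, hl⟩⟩, hang⟩
  · obtain ⟨p, hp, hl, ⟨l, hl0, hp1⟩, hang⟩ := exists_mem_stack_angle_lt hn β hξ fun i _ => hβ i
    exact ⟨p, ⟨hp, Or.inr ⟨hp1 ▸ mul_nonneg hl0 h, hl⟩⟩, hang⟩

/-! ### Counting the turned stacks -/

theorem height_rotation' (α β : ℝ) (p : E3) :
    height β (rotation α p) = Real.cos (β - α) * p 2 + Real.sin (β - α) * p 0 := by
  rw [height, rotation_apply_zero, rotation_apply_two, Real.cos_sub, Real.sin_sub]; ring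

theorem turnedStack_ne {n k l : ℕ} (hkl : k < l) (hl : l < n) :
    turnedStack n k ≠ turnedStack n l := by
  have hn : 1 ≤ n := by omega
  intro h
  have hθ := theta_pos hn
  have hπ := nat_mul_theta hn
  have hs := sin_theta_pos hn
  rw [turnedStack_eq hn, turnedStack_eq hn] at h
  -- The midpoint of the eastern arc nearest to the turned pole. About the axis of the other stack
  -- its height is `cos δ cos ϑₙ`.
  set q := rotation (2 * k * theta n) !₂[0, Real.sin (theta n), Real.cos (theta n)] with hq
  have hq1 : q 1 = Real.sin (theta n) := rfl
  have hqk : q ∈ doubleStack n 0 (2 * k * theta n) := by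
    refine ⟨?_, Or.inr ⟨hs.le, 0, ?_⟩⟩
    · rw [norm_rotation, norm_eq_one_iff]
      simp
    · rw [height_rotation]; simp
  rw [h] at hqk
  rcases hqk.2 with ⟨h1, -⟩ | ⟨-, h2⟩
  · rw [hq1] at h1; linarith
  · obtain ⟨i, hi, hi'⟩ := h2.exists_lt hn
    have hmem := odd_mul_theta_mem hi
    rw [hq, height_rotation'] at hi'
    have hkl' : (k : ℝ) + 1 ≤ l := by exact_mod_cast hkl
    have hln : (l : ℝ) + 1 ≤ n := by exact_mod_cast hl
    have hk0 : (0 : ℝ) ≤ k := by positivity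
    set δ := 2 * l * theta n - 2 * k * theta n with hδ
    have e : Real.cos δ * Real.cos (theta n) = Real.cos ((2 * i + 1) * theta n) := by
      rw [← hi']; simp
    have hδ1 : 2 * theta n ≤ δ := by nlinarith
    have hδ2 : δ ≤ Real.pi - 2 * theta n := by nlinarith
    have hsδ : 0 < Real.sin δ := Real.sin_pos_of_pos_of_lt_pi (by linarith) (by linarith)
    have hprod := mul_pos hsδ hs
    -- The height lies strictly between `cos (δ + ϑₙ)` and `cos (δ - ϑₙ)`, which are consecutive
    -- levels, so it is not a level itself.
    have h3 : Real.cos (δ + theta n) < Real.cos ((2 * i + 1) * theta n) := by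
      rw [← e, Real.cos_add]; linarith
    have h4 : Real.cos ((2 * i + 1) * theta n) < Real.cos (δ - theta n) := by
      rw [← e, Real.cos_sub δ (theta n)]; linarith
    have h5 : (2 * i + 1) * theta n < δ + theta n := by
      by_contra! hc
      exact absurd h3 (not_lt.2 (Real.cos_le_cos_of_nonneg_of_le_pi (by linarith)
        (by linarith [hmem.2]) hc))
    have h6 : δ - theta n < (2 * i + 1) * theta n := by
      by_contra! hc
      exact absurd h4 (not_lt.2 (Real.cos_le_cos_of_nonneg_of_le_pi (by linarith [hmem.1])
        (by linarith) hc))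
    have h7 : (i : ℝ) + k < l := by
      by_contra! hc
      nlinarith
    have h8 : (l : ℝ) < i + k + 1 := by
      by_contra! hc
      nlinarith
    have h7' : i + k < l := by exact_mod_cast h7
    have h8' : l < i + k + 1 := by exact_mod_cast h8
    omega

theorem ncard_turnedStack (n : ℕ) :
    Set.ncard {Γ : Set E3 | ∃ k < n, Nat.gcd k n = 1 ∧ Γ = turnedStack n k} = Nat.totient n := by
  have e : {Γ : Set E3 | ∃ k < n, Nat.gcd k n = 1 ∧ Γ = turnedStack n k} =
      turnedStack n '' ((Finset.range n).filter n.Coprime : Finset ℕ) := by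
    ext Γ
    simp only [mem_ofPred_eq, mem_image, Finset.coe_filter, Finset.mem_range]
    constructor
    · rintro ⟨k, hk, hg, rfl⟩
      exact ⟨k, ⟨hk, Nat.Coprime.symm hg⟩, rfl⟩
    · rintro ⟨k, ⟨hk, hg⟩, rfl⟩
      exact ⟨k, hk, Nat.Coprime.symm hg, rfl⟩
  rw [e, Set.InjOn.ncard_image, Set.ncard_coe_finset]
  · rfl
  · intro k hk l hl h
    simp only [Finset.coe_filter, Finset.mem_range, mem_ofPred_eq] at hk hl
    rcases lt_trichotomy k l with hkl | hkl | hkl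
    · exact absurd h (turnedStack_ne hkl hl.1)
    · exact hkl
    · exact absurd h.symm (turnedStack_ne hkl hk.1)

/-! ### Gluing pieces at the integers -/

/-- The map which agrees with `q j` on `[j, j + 1)`. -/
noncomputable def glue {E : Type*} (q : ℤ → ℝ → E) (x : ℝ) : E := q ⌊x⌋ x

theorem glue_eq {E : Type*} {q : ℤ → ℝ → E} (hq : ∀ j : ℤ, q j (j + 1) = q (j + 1) (j + 1)) {j : ℤ}
    {x : ℝ} (hx : x ∈ Icc (j : ℝ) (j + 1)) : glue q x = q j x := by
  rcases hx.2.lt_or_eq with h | h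
  · rw [glue, Int.floor_eq_iff.2 ⟨hx.1, h⟩]
  · have : ⌊x⌋ = j + 1 := Int.floor_eq_iff.2 ⟨by push_cast; exact h.ge, by push_cast; linarith⟩
    rw [glue, this, h, hq]

theorem mem_Icc_floor (x : ℝ) : x ∈ Icc (⌊x⌋ : ℝ) (⌊x⌋ + 1) :=
  ⟨Int.floor_le x, (Int.lt_floor_add_one x).le⟩

theorem mem_Ioc_ceil (x : ℝ) : x ∈ Ioc ((⌈x⌉ - 1 : ℤ) : ℝ) ((⌈x⌉ - 1 : ℤ) + 1) := by
  push_cast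
  exact ⟨by linarith [Int.ceil_lt_add_one x], by linarith [Int.le_ceil x]⟩

theorem eqOn_glue_Ici {E : Type*} {q : ℤ → ℝ → E} (x : ℝ) :
    glue q =ᶠ[nhdsWithin x (Ici x)] q ⌊x⌋ := by
  have : Ico x (⌊x⌋ + 1 : ℝ) ∈ nhdsWithin x (Ici x) := Ico_mem_nhdsGE (Int.lt_floor_add_one x)
  filter_upwards [this] with y hy
  rw [glue, Int.floor_eq_iff.2 ⟨(Int.floor_le x).trans hy.1, hy.2⟩]

theorem eqOn_glue_Iic {E : Type*} {q : ℤ → ℝ → E} (hq : ∀ j : ℤ, q j (j + 1) = q (j + 1) (j + 1))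
    (x : ℝ) : glue q =ᶠ[nhdsWithin x (Iic x)] q (⌈x⌉ - 1) := by
  have hx := mem_Ioc_ceil x
  filter_upwards [Ioc_mem_nhdsLE hx.1] with y hy
  exact glue_eq hq ⟨hy.1.le, hy.2.trans hx.2⟩

theorem continuous_glue {E : Type*} [TopologicalSpace E] {q : ℤ → ℝ → E}
    (hq : ∀ j : ℤ, q j (j + 1) = q (j + 1) (j + 1)) (hc : ∀ j, Continuous (q j)) :
    Continuous (glue q) := by
  refine continuous_iff_continuousAt.2 fun x => continuousAt_iff_continuous_left_right.2 ⟨?_, ?_⟩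
  · exact (hc _).continuousWithinAt.congr_of_eventuallyEq (eqOn_glue_Iic hq x)
      (glue_eq hq (Ioc_subset_Icc_self (mem_Ioc_ceil x)))
  · exact (hc _).continuousWithinAt.congr_of_eventuallyEq (eqOn_glue_Ici x) rfl

/-- The one-sided derivatives come from neighbouring pieces and agree by `hq'`. -/
theorem hasDerivAt_glue {E : Type*} [NormedAddCommGroup E] [NormedSpace ℝ E] {q q' : ℤ → ℝ → E}
    (hq : ∀ j : ℤ, q j (j + 1) = q (j + 1) (j + 1))
    (hq' : ∀ j : ℤ, q' j (j + 1) = q' (j + 1) (j + 1))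
    (hd : ∀ j x, HasDerivAt (q j) (q' j x) x) (x : ℝ) : HasDerivAt (glue q) (glue q' x) x := by
  have h1 : HasDerivWithinAt (glue q) (glue q' x) (Iic x) x := by
    have hx := Ioc_subset_Icc_self (mem_Ioc_ceil x)
    rw [glue_eq hq' hx]
    exact (hd _ x).hasDerivWithinAt.congr_of_eventuallyEq (eqOn_glue_Iic hq x) (glue_eq hq hx)
  have h2 : HasDerivWithinAt (glue q) (glue q' x) (Ici x) x :=
    (hd _ x).hasDerivWithinAt.congr_of_eventuallyEq (eqOn_glue_Ici x) rfl
  have := h1.union h2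
  rwa [Iic_union_Ici, hasDerivWithinAt_univ] at this

/-! ### Half circles and their parametrization -/

/-- The unit vector along the axis of rotation. -/
noncomputable def eastPole : E3 := !₂[0, 1, 0]

/-- A parametrization of the half circle about the axis at the angle `α` which starts at the point
of `y = 0` at the angle `ψ` from the axis and lies on the side `ε`. -/
noncomputable def arc (α ψ ε u : ℝ) : E3 :=
  Real.cos ψ • axisPoint α + (Real.sin ψ * Real.cos u) • axisPoint (α + Real.pi / 2) +
    (ε * |Real.sin ψ| * Real.sin u) • eastPole

/-- The derivative of `arc`. -/
noncomputable def arcDeriv (α ψ ε u : ℝ) : E3 :=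
  (-(Real.sin ψ * Real.sin u)) • axisPoint (α + Real.pi / 2) +
    (ε * |Real.sin ψ| * Real.cos u) • eastPole

theorem hasDerivAt_arc (α ψ ε u : ℝ) : HasDerivAt (arc α ψ ε) (arcDeriv α ψ ε u) u := by
  have h1 := ((Real.hasDerivAt_cos u).const_mul (Real.sin ψ)).smul_const
    (axisPoint (α + Real.pi / 2))
  have h2 := ((Real.hasDerivAt_sin u).const_mul (ε * |Real.sin ψ|)).smul_const eastPole
  have := (h1.const_add (Real.cos ψ • axisPoint α)).add h2
  rwa [mul_neg] at this

theorem height_add (α : ℝ) (p q : E3) : height α (p + q) = height α p + height α q := by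
  simp [height]; ring
theorem height_smul (α c : ℝ) (p : E3) : height α (c • p) = c * height α p := by
  simp [height]; ring
theorem horiz_add (α : ℝ) (p q : E3) : horiz α (p + q) = horiz α p + horiz α q := by
  simp [horiz]; ring
theorem horiz_smul (α c : ℝ) (p : E3) : horiz α (c • p) = c * horiz α p := by
  simp [horiz]; ring
theorem axisPoint_apply_one (φ : ℝ) : axisPoint φ 1 = 0 := rfl
theorem eastPole_apply_one : eastPole 1 = 1 := rfl
theorem height_eastPole (α : ℝ) : height α eastPole = 0 := by simp [height, eastPole]
theorem horiz_eastPole (α : ℝ) : horiz α eastPole = 0 := by simp [horiz, eastPole]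

theorem height_arc (α ψ ε u : ℝ) : height α (arc α ψ ε u) = Real.cos ψ := by
  simp [arc, height_add, height_smul, height_axisPoint, height_eastPole]

theorem horiz_arc (α ψ ε u : ℝ) : horiz α (arc α ψ ε u) = Real.sin ψ * Real.cos u := by
  simp [arc, horiz_add, horiz_smul, horiz_axisPoint, horiz_eastPole]

theorem arc_apply_one (α ψ ε u : ℝ) : arc α ψ ε u 1 = ε * |Real.sin ψ| * Real.sin u := by
  simp [arc, axisPoint_apply_one, eastPole_apply_one]

theorem norm_sq_eq (α : ℝ) (p : E3) : ‖p‖ ^ 2 = height α p ^ 2 + horiz α p ^ 2 + p 1 ^ 2 := by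
  rw [← real_inner_self_eq_norm_sq, inner_eq_height_horiz α]; ring

theorem norm_arc {ε : ℝ} (hε : ε ^ 2 = 1) (α ψ u : ℝ) : ‖arc α ψ ε u‖ = 1 := by
  rw [← sq_eq_sq₀ (norm_nonneg _) one_pos.le, norm_sq_eq α, height_arc, horiz_arc, arc_apply_one,
    mul_pow, mul_pow, mul_pow, hε, sq_abs]
  linear_combination Real.sin ψ ^ 2 * Real.sin_sq_add_cos_sq u + Real.sin_sq_add_cos_sq ψ

theorem norm_arcDeriv {ε : ℝ} (hε : ε ^ 2 = 1) (α ψ u : ℝ) :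
    ‖arcDeriv α ψ ε u‖ = |Real.sin ψ| := by
  have h1 : height α (arcDeriv α ψ ε u) = 0 := by
    simp [-neg_smul, arcDeriv, height_add, height_smul, height_axisPoint, height_eastPole]
  have h2 : horiz α (arcDeriv α ψ ε u) = -(Real.sin ψ * Real.sin u) := by
    simp [-neg_smul, arcDeriv, horiz_add, horiz_smul, horiz_axisPoint, horiz_eastPole]
  have h3 : arcDeriv α ψ ε u 1 = ε * |Real.sin ψ| * Real.cos u := by
    simp [arcDeriv, axisPoint_apply_one, eastPole_apply_one]
  rw [← sq_eq_sq₀ (norm_nonneg _) (abs_nonneg _), norm_sq_eq α, h1, h2, h3, sq_abs, neg_sq,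
    mul_pow, mul_pow, mul_pow, hε, sq_abs]
  linear_combination Real.sin ψ ^ 2 * Real.sin_sq_add_cos_sq u

/-- The signed `sin ψ` in the horizontal part makes this hold for negative `ψ` too, while the
absolute value in the `y` part leaves the side to `ε` alone. -/
theorem arc_zero (α ψ ε : ℝ) : arc α ψ ε 0 = axisPoint (α + ψ) :=
  ext_height (α := α) (by rw [height_arc, height_axisPoint, add_sub_cancel_left])
    (by rw [horiz_arc, horiz_axisPoint, add_sub_cancel_left, Real.cos_zero, mul_one])
    (by rw [arc_apply_one, Real.sin_zero, mul_zero, axisPoint_apply_one])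

theorem arc_pi (α ψ ε : ℝ) : arc α ψ ε Real.pi = axisPoint (α - ψ) :=
  ext_height (α := α) (by rw [height_arc, height_axisPoint, sub_sub_cancel_left, Real.cos_neg])
    (by rw [horiz_arc, horiz_axisPoint, sub_sub_cancel_left, Real.cos_pi, Real.sin_neg, mul_neg_one])
    (by rw [arc_apply_one, Real.sin_pi, mul_zero, axisPoint_apply_one])

/-- A cubic change of parameter from `[0, 1]` to `[0, π]` with the derivative `π a` at both ends. -/
noncomputable def repar (a s : ℝ) : ℝ := Real.pi * (s + (a - 1) * (s * (1 - s) * (1 - 2 * s)))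

/-- The derivative of `repar`. -/
noncomputable def reparDeriv (a s : ℝ) : ℝ := Real.pi * (1 + (a - 1) * (1 - 6 * s + 6 * s ^ 2))

theorem hasDerivAt_repar (a s : ℝ) : HasDerivAt (repar a) (reparDeriv a s) s := by
  have h : HasDerivAt (fun s : ℝ => s * (1 - s) * (1 - 2 * s)) (1 - 6 * s + 6 * s ^ 2) s := by
    have h1 := (hasDerivAt_id' s).mul ((hasDerivAt_id' s).const_sub 1)
    have h2 := h1.mul (((hasDerivAt_id' s).const_mul 2).const_sub 1)
    convert! h2 using 1
    simp only [Pi.mul_apply]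
    ring
  exact ((hasDerivAt_id' s).add (h.const_mul (a - 1))).const_mul Real.pi

theorem repar_zero (a : ℝ) : repar a 0 = 0 := by simp [repar]
theorem repar_one (a : ℝ) : repar a 1 = Real.pi := by simp [repar]
theorem reparDeriv_zero (a : ℝ) : reparDeriv a 0 = Real.pi * a := by simp [reparDeriv]
theorem reparDeriv_one (a : ℝ) : reparDeriv a 1 = Real.pi * a := by simp [reparDeriv]

/-- The second factor equals `a + 6(1 - a)s(1 - s)`. -/
theorem reparDeriv_pos {a s : ℝ} (ha : 0 < a) (ha' : a ≤ 1) (hs : s ∈ Icc (0 : ℝ) 1) :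
    0 < reparDeriv a s := by
  refine mul_pos Real.pi_pos ?_
  have : s * (1 - s) ≥ 0 := mul_nonneg hs.1 (by linarith [hs.2])
  nlinarith [mul_nonneg (sub_nonneg.2 ha') this]

theorem strictMonoOn_repar {a : ℝ} (ha : 0 < a) (ha' : a ≤ 1) :
    StrictMonoOn (repar a) (Icc 0 1) := by
  refine strictMonoOn_of_deriv_pos (convex_Icc 0 1)
    (fun s _ => (hasDerivAt_repar a s).continuousAt.continuousWithinAt) fun s hs => ?_
  rw [(hasDerivAt_repar a s).deriv]
  rw [interior_Icc] at hs
  exact reparDeriv_pos ha ha' (Ioo_subset_Icc_self hs)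

theorem continuous_repar (a : ℝ) : Continuous (repar a) := by
  unfold repar; fun_prop

theorem continuous_reparDeriv (a : ℝ) : Continuous (reparDeriv a) := by
  unfold reparDeriv; fun_prop

theorem repar_mem_Ico {a s : ℝ} (ha : 0 < a) (ha' : a ≤ 1) (hs : s ∈ Ico (0 : ℝ) 1) :
    repar a s ∈ Ico 0 Real.pi := by
  have hm := strictMonoOn_repar ha ha'
  constructor
  · rw [← repar_zero a]
    exact hm.monotoneOn ⟨le_rfl, zero_le_one⟩ (Ico_subset_Icc_self hs) hs.1
  · rw [← repar_one a]
    exact hm (Ico_subset_Icc_self hs) ⟨zero_le_one, le_rfl⟩ hs.2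

theorem exists_repar_eq (a : ℝ) {u : ℝ} (hu : u ∈ Icc 0 Real.pi) :
    ∃ s ∈ Icc (0 : ℝ) 1, repar a s = u := by
  have := intermediate_value_Icc zero_le_one (continuous_repar a).continuousOn
  rw [repar_zero, repar_one] at this
  exact this hu

/-! ### The closed walk through the half circles -/

/-- The alternating sign of the pieces. -/
noncomputable def sgn (j : ℤ) : ℝ := (-1) ^ j

theorem sgn_add_one (j : ℤ) : sgn (j + 1) = - sgn j := by
  rw [sgn, sgn, zpow_add_one₀ (by norm_num)]; ring

theorem sgn_of_even {j : ℤ} (h : Even j) : sgn j = 1 := h.neg_one_zpow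
theorem sgn_of_odd {j : ℤ} (h : Odd j) : sgn j = -1 := h.neg_one_zpow

theorem sgn_sq (j : ℤ) : sgn j ^ 2 = 1 := by
  rcases Int.even_or_odd j with h | h
  · rw [sgn_of_even h]; norm_num
  · rw [sgn_of_odd h]; norm_num

theorem neg_sgn_sq (j : ℤ) : (-sgn j) ^ 2 = 1 := by rw [neg_sq, sgn_sq]

theorem sgn_add_two_mul (j m : ℤ) : sgn (j + 2 * m) = sgn j := by
  rw [sgn, sgn, zpow_add₀ (by norm_num), (even_two_mul m).neg_one_zpow, mul_one]

/-- The axis of the `j`-th arc. -/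
noncomputable def arcAxis (n k : ℕ) (j : ℤ) : ℝ := (1 - sgn j) * k * theta n

/-- The angle from the axis of the `j`-th arc to its starting point. -/
noncomputable def arcAngle (n k : ℕ) (j : ℤ) : ℝ := sgn j * ((2 * k * j + 1) * theta n)

/-- The end of an arc is the start of the next. Even arcs are western about the axis `0`, odd ones
eastern about `2kϑₙ`, and reflecting in the two axes in turn shifts the seam angle by `4kϑₙ`. -/
theorem arcAxis_sub_arcAngle (n k : ℕ) (j : ℤ) :
    arcAxis n k j - arcAngle n k j = arcAxis n k (j + 1) + arcAngle n k (j + 1) := by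
  simp only [arcAxis, arcAngle, sgn_add_one]
  push_cast
  ring

theorem cos_arcAngle (n k : ℕ) (j : ℤ) :
    Real.cos (arcAngle n k j) = Real.cos ((2 * k * j + 1) * theta n) := by
  rcases Int.even_or_odd j with h | h
  · rw [arcAngle, sgn_of_even h, one_mul]
  · rw [arcAngle, sgn_of_odd h, neg_one_mul, Real.cos_neg]

theorem isLevel_cos_arcAngle (n k : ℕ) (j : ℤ) : IsLevel n (Real.cos (arcAngle n k j)) :=
  ⟨k * j, by rw [cos_arcAngle]; push_cast; congr 1; ring⟩

theorem sin_theta_le_abs_sin {n : ℕ} (hn : 1 ≤ n) {ψ : ℝ} (h : IsLevel n (Real.cos ψ)) :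
    Real.sin (theta n) ≤ |Real.sin ψ| := by
  have h1 := h.abs_le hn
  rw [← sq_le_sq₀ (sin_theta_pos hn).le (abs_nonneg _), sq_abs, Real.sin_sq, Real.sin_sq]
  have := pow_le_pow_left₀ (abs_nonneg _) h1 2
  rw [sq_abs] at this
  linarith

/-- The speed of the `j`-th piece relative to constant speed at its ends. -/
noncomputable def arcSpeed (n k : ℕ) (j : ℤ) : ℝ :=
  Real.sin (theta n) / |Real.sin (arcAngle n k j)|

theorem arcSpeed_mem {n : ℕ} (hn : 1 ≤ n) (k : ℕ) (j : ℤ) : arcSpeed n k j ∈ Ioc (0 : ℝ) 1 := by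
  have h1 := sin_theta_le_abs_sin hn (isLevel_cos_arcAngle n k j)
  have h2 := sin_theta_pos hn
  exact ⟨div_pos h2 (h2.trans_le h1), (div_le_one (h2.trans_le h1)).2 h1⟩

theorem abs_sin_arcAngle_mul_arcSpeed {n : ℕ} (hn : 1 ≤ n) (k : ℕ) (j : ℤ) :
    |Real.sin (arcAngle n k j)| * arcSpeed n k j = Real.sin (theta n) :=
  mul_div_cancel₀ _
    ((sin_theta_pos hn).trans_le (sin_theta_le_abs_sin hn (isLevel_cos_arcAngle n k j))).ne'

/-- The `j`-th piece of the closed curve, parametrized over `[j, j + 1]`. -/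
noncomputable def piece (n k : ℕ) (j : ℤ) (x : ℝ) : E3 :=
  arc (arcAxis n k j) (arcAngle n k j) (-sgn j) (repar (arcSpeed n k j) (x - j))

/-- The derivative of `piece`. -/
noncomputable def pieceDeriv (n k : ℕ) (j : ℤ) (x : ℝ) : E3 :=
  reparDeriv (arcSpeed n k j) (x - j) •
    arcDeriv (arcAxis n k j) (arcAngle n k j) (-sgn j) (repar (arcSpeed n k j) (x - j))

theorem hasDerivAt_piece (n k : ℕ) (j : ℤ) (x : ℝ) :
    HasDerivAt (piece n k j) (pieceDeriv n k j x) x := by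
  have h1 : HasDerivAt (fun x : ℝ => repar (arcSpeed n k j) (x - j))
      (reparDeriv (arcSpeed n k j) (x - j)) x :=
    (hasDerivAt_repar _ _).comp_sub_const x (j : ℝ)
  exact (hasDerivAt_arc _ _ _ _).scomp x h1

theorem continuous_pieceDeriv (n k : ℕ) (j : ℤ) : Continuous (pieceDeriv n k j) := by
  have h1 : Continuous fun x : ℝ => x - (j : ℝ) := by fun_prop
  refine ((continuous_reparDeriv _).comp h1).smul ?_
  have : Continuous (arcDeriv (arcAxis n k j) (arcAngle n k j) (-sgn j)) := by
    unfold arcDeriv; fun_prop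
  exact this.comp ((continuous_repar _).comp h1)

theorem piece_match (n k : ℕ) (j : ℤ) : piece n k j (j + 1) = piece n k (j + 1) (j + 1) := by
  rw [piece, piece, add_sub_cancel_left, repar_one, arc_pi]
  push_cast
  rw [sub_self, repar_zero, arc_zero, arcAxis_sub_arcAngle]

/-- On the seam both tangents are parallel to `eastPole`, and `arcSpeed` gives every piece the speed
`π sin ϑₙ` there; the alternating side makes the signs agree. -/
theorem pieceDeriv_match {n : ℕ} (hn : 1 ≤ n) (k : ℕ) (j : ℤ) :
    pieceDeriv n k j (j + 1) = pieceDeriv n k (j + 1) (j + 1) := by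
  rw [pieceDeriv, pieceDeriv, add_sub_cancel_left, repar_one, reparDeriv_one]
  push_cast
  rw [sub_self, repar_zero, reparDeriv_zero, sgn_add_one]
  simp only [arcDeriv, Real.sin_pi, Real.cos_pi, Real.sin_zero, Real.cos_zero, mul_zero, neg_zero,
    zero_smul, zero_add, smul_smul]
  congr 1
  linear_combination (Real.pi * sgn j) *
    (abs_sin_arcAngle_mul_arcSpeed hn k j - abs_sin_arcAngle_mul_arcSpeed hn k (j + 1))

theorem norm_pieceDeriv {n : ℕ} (hn : 1 ≤ n) (k : ℕ) {j : ℤ} {x : ℝ}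
    (hx : x ∈ Icc (j : ℝ) (j + 1)) : ‖pieceDeriv n k j x‖ =
      reparDeriv (arcSpeed n k j) (x - j) * |Real.sin (arcAngle n k j)| := by
  have h := arcSpeed_mem hn k j
  rw [pieceDeriv, norm_smul, norm_arcDeriv (neg_sgn_sq j), Real.norm_of_nonneg]
  exact (reparDeriv_pos h.1 h.2 ⟨by linarith [hx.1], by linarith [hx.2]⟩).le

/-- After `2n` arcs the angle has changed by `±4knϑₙ = ±2πk`. -/
theorem piece_add_period {n : ℕ} (hn : 1 ≤ n) (k : ℕ) (j : ℤ) (x : ℝ) :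
    piece n k (j + 2 * n) (x + 2 * n) = piece n k j x := by
  have hπ := nat_mul_theta hn
  have hs : sgn (j + 2 * n) = sgn j := sgn_add_two_mul j n
  have hα : arcAxis n k (j + 2 * n) = arcAxis n k j := by rw [arcAxis, arcAxis, hs]
  have hψ : ∃ m : ℤ, arcAngle n k (j + 2 * n) = arcAngle n k j + m * (2 * Real.pi) := by
    rcases Int.even_or_odd j with h | h
    · refine ⟨k, ?_⟩
      rw [arcAngle, arcAngle, hs, sgn_of_even h, ← hπ]; push_cast; ring
    · refine ⟨-k, ?_⟩
      rw [arcAngle, arcAngle, hs, sgn_of_odd h, ← hπ]; push_cast; ring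
  obtain ⟨m, hm⟩ := hψ
  have hsin : Real.sin (arcAngle n k (j + 2 * n)) = Real.sin (arcAngle n k j) := by
    rw [hm, Real.sin_add_int_mul_two_pi]
  have hcos : Real.cos (arcAngle n k (j + 2 * n)) = Real.cos (arcAngle n k j) := by
    rw [hm, Real.cos_add_int_mul_two_pi]
  have hsp : arcSpeed n k (j + 2 * n) = arcSpeed n k j := by rw [arcSpeed, arcSpeed, hsin]
  have hx : x + 2 * n - ((j + 2 * n : ℤ) : ℝ) = x - j := by push_cast; ring
  rw [piece, piece, hx, hsp, hs, hα, arc, arc, hsin, hcos]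

/-- The closed curve whose image is the turned stack, over the period `2n`. -/
noncomputable def loop (n k : ℕ) : ℝ → E3 := glue (piece n k)

theorem loop_eq_piece {n k : ℕ} {j : ℤ} {x : ℝ} (hx : x ∈ Icc (j : ℝ) (j + 1)) :
    loop n k x = piece n k j x := glue_eq (piece_match n k) hx

theorem hasDerivAt_loop {n : ℕ} (hn : 1 ≤ n) (k : ℕ) (x : ℝ) :
    HasDerivAt (loop n k) (glue (pieceDeriv n k) x) x :=
  hasDerivAt_glue (piece_match n k) (pieceDeriv_match hn k) (hasDerivAt_piece n k) x

theorem continuous_loopDeriv {n : ℕ} (hn : 1 ≤ n) (k : ℕ) : Continuous (glue (pieceDeriv n k)) :=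
  continuous_glue (pieceDeriv_match hn k) (continuous_pieceDeriv n k)

theorem loop_add_period {n : ℕ} (hn : 1 ≤ n) (k : ℕ) (x : ℝ) :
    loop n k (x + 2 * n) = loop n k x := by
  have : ⌊x + 2 * n⌋ = ⌊x⌋ + 2 * n := by
    have := Int.floor_add_intCast x (2 * n)
    push_cast at this
    exact this
  rw [loop, glue, glue, this, piece_add_period hn]

theorem norm_loop (n k : ℕ) (x : ℝ) : ‖loop n k x‖ = 1 := norm_arc (neg_sgn_sq _) _ _ _

theorem norm_loopDeriv {n : ℕ} (hn : 1 ≤ n) (k : ℕ) {j : ℤ} {x : ℝ}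
    (hx : x ∈ Icc (j : ℝ) (j + 1)) : ‖glue (pieceDeriv n k) x‖ =
      reparDeriv (arcSpeed n k j) (x - j) * |Real.sin (arcAngle n k j)| := by
  rw [glue_eq (pieceDeriv_match hn k) hx, norm_pieceDeriv hn k hx]

theorem loopDeriv_ne_zero {n : ℕ} (hn : 1 ≤ n) (k : ℕ) (x : ℝ) : glue (pieceDeriv n k) x ≠ 0 := by
  have hx := mem_Icc_floor x
  rw [← norm_pos_iff, norm_loopDeriv hn k hx]
  have h := arcSpeed_mem hn k ⌊x⌋
  refine mul_pos (reparDeriv_pos h.1 h.2 ⟨by linarith [hx.1], by linarith [hx.2]⟩) ?_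
  exact (sin_theta_pos hn).trans_le (sin_theta_le_abs_sin hn (isLevel_cos_arcAngle n k _))

/-! ### Simplicity of the loop -/

/-- Here coprimality acts: with `i - j = 2d`, `n` divides `k d`, hence `d`, and `|d| < n`. -/
theorem eq_of_mul_eq {n k : ℕ} (hk : Nat.gcd k n = 1) {i j m : ℤ} (hi : i ∈ Ico 0 (2 * (n : ℤ)))
    (hj : j ∈ Ico 0 (2 * (n : ℤ))) (hij : Even (i - j)) (h : k * (i - j) = 2 * n * m) : i = j := by
  obtain ⟨d, hd⟩ := hij
  have h1 : (n : ℤ) ∣ k * d := ⟨m, by rw [hd] at h; linarith⟩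
  have hc : IsCoprime (n : ℤ) k := by
    rw [Nat.isCoprime_iff_coprime]; exact Nat.Coprime.symm hk
  have h2 : (n : ℤ) ∣ d := hc.dvd_of_dvd_mul_left h1
  have h3 : d = 0 := Int.eq_zero_of_abs_lt_dvd h2 (abs_lt.2 ⟨by linarith [hi.1, hj.2], by
    linarith [hi.2, hj.1]⟩)
  rw [h3] at hd
  linarith

theorem eq_of_cos_arcAngle_eq {n k : ℕ} (hn : 1 ≤ n) (hk : Nat.gcd k n = 1) {i j : ℤ}
    (hi : i ∈ Ico 0 (2 * (n : ℤ))) (hj : j ∈ Ico 0 (2 * (n : ℤ))) (hij : Even (i - j))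
    (h : Real.cos (arcAngle n k i) = Real.cos (arcAngle n k j)) : i = j := by
  have hθ := theta_pos hn
  have hπ := nat_mul_theta hn
  rw [cos_arcAngle, cos_arcAngle, Real.cos_eq_cos_iff] at h
  obtain ⟨m, h | h⟩ := h
  · have h1 : (2 * k * j + 1 : ℝ) = 4 * n * m + (2 * k * i + 1) := by
      apply mul_right_cancel₀ hθ.ne'; rw [h, ← hπ]; ring
    have h2 : (2 * k * j + 1 : ℤ) = 4 * n * m + (2 * k * i + 1) := by exact_mod_cast h1
    exact eq_of_mul_eq hk hi hj hij (m := -m) (by linarith)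
  -- The opposite sign is impossible by parity: `k(i + j) + 1` would be even although `i + j` is
  -- even.
  · have h1 : (2 * k * j + 1 : ℝ) = 4 * n * m - (2 * k * i + 1) := by
      apply mul_right_cancel₀ hθ.ne'; rw [h, ← hπ]; ring
    have h2 : (2 * k * j + 1 : ℤ) = 4 * n * m - (2 * k * i + 1) := by exact_mod_cast h1
    obtain ⟨d, hd⟩ := hij
    have h3 : 2 * (k * (j + d)) + 1 = 2 * (n * m) := by
      have : i = j + d + d := by linarith
      rw [this] at h2
      linarith
    omega

/-- Different arcs start at different seam points. Indices of equal parity reduce to `eq_of_mul_eq`;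
mixed parity equates an odd and an even number. -/
theorem eq_of_axisPoint_eq {n k : ℕ} (hn : 1 ≤ n) (hk : Nat.gcd k n = 1) {i j : ℤ}
    (hi : i ∈ Ico 0 (2 * (n : ℤ))) (hj : j ∈ Ico 0 (2 * (n : ℤ)))
    (h : axisPoint (arcAxis n k i + arcAngle n k i) = axisPoint (arcAxis n k j + arcAngle n k j)) :
    i = j := by
  have hθ := theta_pos hn
  have hπ := nat_mul_theta hn
  have h1 : Real.cos (arcAxis n k i + arcAngle n k i - (arcAxis n k j + arcAngle n k j)) = 1 := by
    rw [← height_axisPoint, h, height_axisPoint, sub_self, Real.cos_zero]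
  rw [Real.cos_eq_one_iff] at h1
  obtain ⟨m, hm⟩ := h1
  rw [arcAxis, arcAxis, arcAngle, arcAngle, ← hπ] at hm
  have key : (1 - sgn i) * k + sgn i * (2 * k * i + 1) -
      ((1 - sgn j) * k + sgn j * (2 * k * j + 1)) = 4 * n * m := by
    apply mul_right_cancel₀ hθ.ne'; linarith
  rcases Int.even_or_odd i with hi' | hi' <;> rcases Int.even_or_odd j with hj' | hj'
  · rw [sgn_of_even hi', sgn_of_even hj'] at key
    have key' : (2 * k * i - 2 * k * j : ℝ) = 4 * n * m := by linarith
    have key2 : (2 * k * i - 2 * k * j : ℤ) = 4 * n * m := by exact_mod_cast key'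
    exact eq_of_mul_eq hk hi hj (hi'.sub hj') (m := m) (by linarith)
  · rw [sgn_of_even hi', sgn_of_odd hj'] at key
    have key' : (2 * k * i + 2 * k * j - 2 * k + 2 : ℝ) = 4 * n * m := by linarith
    have key2 : (2 * k * i + 2 * k * j - 2 * k + 2 : ℤ) = 4 * n * m := by exact_mod_cast key'
    obtain ⟨a, rfl⟩ := hi'
    obtain ⟨b, rfl⟩ := hj'
    have : 2 * (k * (a + b)) + 1 = 2 * (n * m) := by linarith
    omega
  · rw [sgn_of_odd hi', sgn_of_even hj'] at key
    have key' : (2 * k - 2 * k * i - 2 * k * j - 2 : ℝ) = 4 * n * m := by linarith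
    have key2 : (2 * k - 2 * k * i - 2 * k * j - 2 : ℤ) = 4 * n * m := by exact_mod_cast key'
    obtain ⟨a, rfl⟩ := hi'
    obtain ⟨b, rfl⟩ := hj'
    have : 2 * (k * (a + b)) + 1 = 2 * (n * -m) := by linarith
    omega
  · rw [sgn_of_odd hi', sgn_of_odd hj'] at key
    have key' : (2 * k * j - 2 * k * i : ℝ) = 4 * n * m := by linarith
    have key2 : (2 * k * j - 2 * k * i : ℤ) = 4 * n * m := by exact_mod_cast key'
    exact eq_of_mul_eq hk hi hj (hi'.sub_odd hj') (m := -m) (by linarith)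

theorem abs_sin_arcAngle_pos {n : ℕ} (hn : 1 ≤ n) (k : ℕ) (j : ℤ) :
    0 < |Real.sin (arcAngle n k j)| :=
  (sin_theta_pos hn).trans_le (sin_theta_le_abs_sin hn (isLevel_cos_arcAngle n k j))

/-- Off the seam the sign of `y` determines the parity of the arc and the height then determines the
arc. On the seam the parameter `u` in `[0, π)` must be `0`, so the starting points decide. -/
theorem injOn_loop {n k : ℕ} (hn : 1 ≤ n) (hk : Nat.gcd k n = 1) :
    InjOn (loop n k) (Ico (0 : ℝ) (2 * n)) := by
  intro x hx y hy hxy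
  have hfl : ∀ x ∈ Ico (0 : ℝ) (2 * n), ⌊x⌋ ∈ Ico 0 (2 * (n : ℤ)) := fun x hx =>
    ⟨Int.floor_nonneg.2 hx.1, Int.floor_lt.2 (by push_cast; exact hx.2)⟩
  have hu : ∀ x : ℝ, repar (arcSpeed n k ⌊x⌋) (x - ⌊x⌋) ∈ Ico 0 Real.pi := fun x =>
    repar_mem_Ico (arcSpeed_mem hn k _).1 (arcSpeed_mem hn k _).2
      ⟨by linarith [Int.floor_le x], by linarith [Int.lt_floor_add_one x]⟩
  have hux := hu x
  have huy := hu y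
  have hix := hfl x hx
  have hiy := hfl y hy
  have hrep : ∀ x y : ℝ, ⌊x⌋ = ⌊y⌋ → repar (arcSpeed n k ⌊x⌋) (x - ⌊x⌋) =
      repar (arcSpeed n k ⌊y⌋) (y - ⌊y⌋) → x = y := fun x y h h' => by
    rw [h] at h'
    have := (strictMonoOn_repar (arcSpeed_mem hn k ⌊y⌋).1 (arcSpeed_mem hn k ⌊y⌋).2).injOn
      ⟨by linarith [h ▸ Int.floor_le x], by linarith [h ▸ Int.lt_floor_add_one x]⟩
      ⟨by linarith [Int.floor_le y], by linarith [Int.lt_floor_add_one y]⟩ h'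
    linarith
  have hrep := hrep x y
  change piece n k ⌊x⌋ x = piece n k ⌊y⌋ y at hxy
  rw [piece, piece] at hxy
  set i := ⌊x⌋
  set j := ⌊y⌋
  set u := repar (arcSpeed n k i) (x - i)
  set v := repar (arcSpeed n k j) (y - j)
  have h1 : -sgn i * |Real.sin (arcAngle n k i)| * Real.sin u =
      -sgn j * |Real.sin (arcAngle n k j)| * Real.sin v := by
    rw [← arc_apply_one (arcAxis n k i), hxy, arc_apply_one]
  have hpi := abs_sin_arcAngle_pos hn k i
  have hpj := abs_sin_arcAngle_pos hn k j
  have hsu : 0 ≤ Real.sin u := Real.sin_nonneg_of_nonneg_of_le_pi hux.1 hux.2.le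
  have hsv : 0 ≤ Real.sin v := Real.sin_nonneg_of_nonneg_of_le_pi huy.1 huy.2.le
  have hzero : ∀ u ∈ Ico 0 Real.pi, Real.sin u = 0 → u = 0 := fun u hu h => by
    by_contra hne
    exact absurd h (Real.sin_pos_of_pos_of_lt_pi (lt_of_le_of_ne hu.1 (Ne.symm hne)) hu.2).ne'
  -- pieces on the same side
  have hsame : Even (i - j) → x = y := by
    intro hij
    have hs : sgn i = sgn j := by
      obtain ⟨d, hd⟩ := hij
      rw [show i = j + 2 * d by linarith, sgn_add_two_mul]
    have hα : arcAxis n k i = arcAxis n k j := by rw [arcAxis, arcAxis, hs]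
    have hcos : Real.cos (arcAngle n k i) = Real.cos (arcAngle n k j) := by
      rw [← height_arc (arcAxis n k i) _ (-sgn i) u, hxy, hα, height_arc]
    have hij' := eq_of_cos_arcAngle_eq hn hk hix hiy hij hcos
    refine hrep hij' (Real.injOn_cos (Ico_subset_Icc_self hux) (Ico_subset_Icc_self huy) ?_)
    have h2 : Real.sin (arcAngle n k i) * Real.cos u = Real.sin (arcAngle n k i) * Real.cos v := by
      rw [← horiz_arc (arcAxis n k i) _ (-sgn i) u, hxy, hα, horiz_arc, hij']
    exact mul_left_cancel₀ (abs_pos.1 hpi) h2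
  rcases eq_or_ne (Real.sin u) 0 with h0 | h0
  · have hv0 : Real.sin v = 0 := by
      rw [h0, mul_zero] at h1
      have hne : -sgn j * |Real.sin (arcAngle n k j)| ≠ 0 :=
        mul_ne_zero (fun h => by have := neg_sgn_sq j; rw [h] at this; norm_num at this) hpj.ne'
      exact (mul_eq_zero.1 h1.symm).resolve_left hne
    have hu0 := hzero u hux h0
    have hv0' := hzero v huy hv0
    rw [hu0, hv0', arc_zero, arc_zero] at hxy
    exact hrep (eq_of_axisPoint_eq hn hk hix hiy hxy) (hu0.trans hv0'.symm)
  · have hpu : 0 < |Real.sin (arcAngle n k i)| * Real.sin u :=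
      mul_pos hpi (lt_of_le_of_ne hsu (Ne.symm h0))
    have hpv : 0 ≤ |Real.sin (arcAngle n k j)| * Real.sin v := mul_nonneg hpj.le hsv
    rw [mul_assoc, mul_assoc] at h1
    rcases Int.even_or_odd i with hi | hi <;> rcases Int.even_or_odd j with hj | hj
    · exact hsame (hi.sub hj)
    · rw [sgn_of_even hi, sgn_of_odd hj] at h1; linarith
    · rw [sgn_of_odd hi, sgn_of_even hj] at h1; linarith
    · exact hsame (hi.sub_odd hj)

/-! ### Image and length of the loop -/

/-- The circles of the stack are run through once by the arcs of each side. -/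
theorem exists_perm_levels {n k : ℕ} (hn : 1 ≤ n) (hk : Nat.gcd k n = 1) {b : ℤ}
    (hb : b = 0 ∨ b = 1) : ∃ f : Fin n → Fin n, Function.Bijective f ∧
      ∀ m : Fin n, Real.cos (arcAngle n k (2 * (m : ℕ) + b)) =
        Real.cos ((2 * ((f m : ℕ) : ℝ) + 1) * theta n) := by
  have h : ∀ m : Fin n, ∃ i : Fin n, Real.cos (arcAngle n k (2 * (m : ℕ) + b)) =
      Real.cos ((2 * ((i : ℕ) : ℝ) + 1) * theta n) := fun m => by
    obtain ⟨i, hi, h⟩ := (isLevel_cos_arcAngle n k (2 * (m : ℕ) + b)).exists_lt hn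
    exact ⟨⟨i, hi⟩, h⟩
  choose f hf using h
  refine ⟨f, Finite.injective_iff_bijective.1 fun m m' hmm => ?_, hf⟩
  have hcos := (hf m).trans ((congrArg (fun i : Fin n =>
    Real.cos ((2 * ((i : ℕ) : ℝ) + 1) * theta n)) hmm).trans (hf m').symm)
  have hm := m.2
  have hm' := m'.2
  have := eq_of_cos_arcAngle_eq hn hk (i := 2 * (m : ℕ) + b) (j := 2 * (m' : ℕ) + b)
    ⟨by omega, by omega⟩ ⟨by omega, by omega⟩ ⟨(m : ℤ) - (m' : ℤ), by ring⟩ hcos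
  ext
  omega

theorem loop_mem {n : ℕ} (hn : 1 ≤ n) (k : ℕ) (x : ℝ) :
    loop n k x ∈ doubleStack n 0 (2 * k * theta n) := by
  have hu : repar (arcSpeed n k ⌊x⌋) (x - ⌊x⌋) ∈ Ico 0 Real.pi :=
    repar_mem_Ico (arcSpeed_mem hn k _).1 (arcSpeed_mem hn k _).2
      ⟨by linarith [Int.floor_le x], by linarith [Int.lt_floor_add_one x]⟩
  have hs := mul_nonneg (abs_nonneg (Real.sin (arcAngle n k ⌊x⌋)))
    (Real.sin_nonneg_of_nonneg_of_le_pi hu.1 hu.2.le)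
  refine ⟨norm_loop n k x, ?_⟩
  change piece n k ⌊x⌋ x 1 ≤ 0 ∧ IsLevel n (height 0 (piece n k ⌊x⌋ x)) ∨
    0 ≤ piece n k ⌊x⌋ x 1 ∧ IsLevel n (height (2 * k * theta n) (piece n k ⌊x⌋ x))
  rw [piece, arc_apply_one, mul_assoc]
  have hl := isLevel_cos_arcAngle n k ⌊x⌋
  rcases Int.even_or_odd ⌊x⌋ with h | h
  · have hα : arcAxis n k ⌊x⌋ = 0 := by rw [arcAxis, sgn_of_even h]; ring
    refine Or.inl ⟨?_, ?_⟩
    · rw [sgn_of_even h]; linarith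
    · rwa [hα, height_arc]
  · have hα : arcAxis n k ⌊x⌋ = 2 * k * theta n := by rw [arcAxis, sgn_of_odd h]; ring
    refine Or.inr ⟨?_, ?_⟩
    · rw [sgn_of_odd h]; linarith
    · rwa [hα, height_arc]

theorem exists_arc_eq {α ψ ε : ℝ} {p : E3} (hε : ε ^ 2 = 1) (hp : ‖p‖ = 1)
    (hψ : Real.sin ψ ≠ 0) (hh : height α p = Real.cos ψ) (hy : 0 ≤ ε * p 1) :
    ∃ u ∈ Icc 0 Real.pi, arc α ψ ε u = p := by
  have hs := height_sq_add hp α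
  rw [hh] at hs
  have hs' : horiz α p ^ 2 + p 1 ^ 2 = Real.sin ψ ^ 2 := by
    linarith [Real.sin_sq_add_cos_sq ψ]
  set w := horiz α p / Real.sin ψ with hw
  have hwψ : Real.sin ψ * w = horiz α p := mul_div_cancel₀ _ hψ
  have hw1 : w ^ 2 ≤ 1 := by
    rw [hw, div_pow, div_le_one (by positivity)]; nlinarith [sq_nonneg (p 1)]
  obtain ⟨hw2, hw3⟩ := abs_le.1 ((sq_le_one_iff_abs_le_one _).1 hw1)
  refine ⟨Real.arccos w, ⟨Real.arccos_nonneg _, Real.arccos_le_pi _⟩, ext_height (α := α) ?_ ?_ ?_⟩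
  · rw [height_arc, hh]
  · rw [horiz_arc, Real.cos_arccos hw2 hw3, hwψ]
  · rw [arc_apply_one, Real.sin_arccos, mul_assoc]
    have h1 : |Real.sin ψ| * √(1 - w ^ 2) = ε * p 1 := by
      rw [← sq_eq_sq₀ (by positivity) hy, mul_pow, mul_pow, sq_abs, Real.sq_sqrt (by linarith), hε]
      linear_combination -hs' - (Real.sin ψ * w + horiz α p) * hwψ
    rw [h1]
    linear_combination p 1 * hε

theorem range_loop {n k : ℕ} (hn : 1 ≤ n) (hk : Nat.gcd k n = 1) :
    Set.range (loop n k) = doubleStack n 0 (2 * k * theta n) := by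
  refine Subset.antisymm (by rintro _ ⟨x, rfl⟩; exact loop_mem hn k x) ?_
  intro p hp
  have key : ∀ b : ℤ, b = 0 ∨ b = 1 → IsLevel n (height (arcAxis n k b) p) → 0 ≤ -sgn b * p 1 →
      p ∈ Set.range (loop n k) := by
    intro b hb hl hy
    obtain ⟨f, hf, hcos⟩ := exists_perm_levels hn hk hb
    obtain ⟨i, hi, hi'⟩ := hl.exists_lt hn
    obtain ⟨m, hm⟩ := hf.2 ⟨i, hi⟩
    have hm' := hcos m
    rw [hm] at hm'
    -- The arc on the side `b` that runs along the circle of `p`; it exists because the arcs of one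
    -- side permute the levels.
    set j : ℤ := 2 * (m : ℕ) + b with hj
    have hsj : sgn j = sgn b := by rw [hj, add_comm, sgn_add_two_mul]
    have hαj : arcAxis n k b = arcAxis n k j := by rw [arcAxis, arcAxis, hsj]
    obtain ⟨u, hu, hup⟩ := exists_arc_eq (α := arcAxis n k j) (ψ := arcAngle n k j)
      (neg_sgn_sq j) hp.1 (abs_pos.1 (abs_sin_arcAngle_pos hn k j))
      (by rw [← hαj, hi', hm']) (by rwa [hsj])
    obtain ⟨s, hs, hsu⟩ := exists_repar_eq (arcSpeed n k j) hu
    refine ⟨j + s, ?_⟩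
    rw [loop_eq_piece (j := j) ⟨by linarith [hs.1], by linarith [hs.2]⟩, piece, add_sub_cancel_left,
      hsu, hup]
  rcases hp.2 with ⟨h1, h2⟩ | ⟨h1, h2⟩
  · refine key 0 (Or.inl rfl) ?_ ?_
    · rwa [show arcAxis n k 0 = 0 by simp [arcAxis, sgn]]
    · rw [sgn_of_even Even.zero]; linarith
  · refine key 1 (Or.inr rfl) ?_ ?_
    · rwa [show arcAxis n k 1 = 2 * k * theta n by rw [arcAxis, sgn_of_odd odd_one]; ring]
    · rw [sgn_of_odd odd_one]; linarith

/-- Multiplied by `2 sin ϑₙ`, the sum telescopes to `cos 0 - cos π`. -/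
theorem sum_sin_odd_mul_theta {n : ℕ} (hn : 1 ≤ n) :
    ∑ i ∈ Finset.range n, Real.sin ((2 * i + 1) * theta n) = 1 / Real.sin (theta n) := by
  have hs := sin_theta_pos hn
  have htel : ∀ i : ℕ, 2 * Real.sin (theta n) * Real.sin ((2 * i + 1) * theta n) =
      Real.cos (2 * i * theta n) - Real.cos (2 * (i + 1 : ℕ) * theta n) := fun i => by
    rw [Real.cos_sub_cos, show (2 * i * theta n + 2 * (i + 1 : ℕ) * theta n) / 2 =
      (2 * i + 1) * theta n by push_cast; ring, show (2 * i * theta n - 2 * (i + 1 : ℕ) * theta n) / 2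
      = -theta n by push_cast; ring, Real.sin_neg]
    ring
  have hsum : 2 * Real.sin (theta n) * ∑ i ∈ Finset.range n, Real.sin ((2 * i + 1) * theta n) =
      2 := by
    rw [Finset.mul_sum, Finset.sum_congr rfl fun i _ => htel i,
      Finset.sum_range_sub' (fun i : ℕ => Real.cos (2 * i * theta n)), nat_mul_theta hn]
    simp; norm_num
  rw [eq_div_iff hs.ne']
  linarith

theorem sum_abs_sin_arcAngle {n k : ℕ} (hn : 1 ≤ n) (hk : Nat.gcd k n = 1) {b : ℤ}
    (hb : b = 0 ∨ b = 1) : ∑ m ∈ Finset.range n, |Real.sin (arcAngle n k (2 * m + b))| =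
      1 / Real.sin (theta n) := by
  obtain ⟨f, hf, hcos⟩ := exists_perm_levels hn hk hb
  rw [← sum_sin_odd_mul_theta hn, Finset.sum_range, Finset.sum_range,
    ← hf.sum_comp fun i : Fin n => Real.sin ((2 * ((i : ℕ) : ℝ) + 1) * theta n)]
  refine Finset.sum_congr rfl fun m _ => ?_
  have hmem := odd_mul_theta_mem (f m).2
  have hθ := theta_pos hn
  rw [Real.abs_sin_eq_sqrt_one_sub_cos_sq, hcos m, ← Real.abs_sin_eq_sqrt_one_sub_cos_sq,
    abs_of_nonneg (Real.sin_nonneg_of_nonneg_of_le_pi (by linarith [hmem.1])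
      (by linarith [hmem.2]))]

/-- Each piece has the length `π |sin ψ|` of a half circle; even and odd pieces each contribute `π /
sin ϑₙ`. -/
theorem integral_norm_loopDeriv {n k : ℕ} (hn : 1 ≤ n) (hk : Nat.gcd k n = 1) :
    ∫ x in (0 : ℝ)..(2 * n), ‖glue (pieceDeriv n k) x‖ = 2 * Real.pi / Real.sin (theta n) := by
  have hc := (continuous_loopDeriv hn k).norm
  have hpiece : ∀ j : ℕ, ∫ x in (j : ℝ)..((j + 1 : ℕ) : ℝ), ‖glue (pieceDeriv n k) x‖ =
      Real.pi * |Real.sin (arcAngle n k j)| := fun j => by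
    have hj : ((j + 1 : ℕ) : ℝ) = j + 1 := by push_cast; ring
    rw [hj]
    have e : ∫ x in (j : ℝ)..(j + 1), ‖glue (pieceDeriv n k) x‖ =
        ∫ x in (j : ℝ)..(j + 1), reparDeriv (arcSpeed n k j) (x - j) *
          |Real.sin (arcAngle n k j)| := by
      refine intervalIntegral.integral_congr fun x hx => ?_
      rw [uIcc_of_le (by linarith)] at hx
      exact norm_loopDeriv hn k (j := j) (by exact_mod_cast hx)
    rw [e, intervalIntegral.integral_mul_const,
      intervalIntegral.integral_comp_sub_right (fun x => reparDeriv (arcSpeed n k j) x),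
      sub_self, add_sub_cancel_left,
      intervalIntegral.integral_eq_sub_of_hasDerivAt (fun x _ => hasDerivAt_repar _ x)
        ((continuous_reparDeriv _).intervalIntegrable _ _), repar_one, repar_zero, sub_zero]
  have hsum := intervalIntegral.sum_integral_adjacent_intervals (μ := volume) (n := 2 * n)
    (a := fun j : ℕ => (j : ℝ)) (f := fun x => ‖glue (pieceDeriv n k) x‖)
    (fun j _ => hc.intervalIntegrable _ _)
  have hcast : ((2 * n : ℕ) : ℝ) = 2 * n := by push_cast; ring
  simp only [hcast, Nat.cast_zero] at hsum
  rw [← hsum, Finset.sum_congr rfl fun j _ => hpiece j, ← Finset.mul_sum]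
  have hsplit : ∀ (g : ℕ → ℝ) (N : ℕ), ∑ j ∈ Finset.range (2 * N), g j =
      ∑ m ∈ Finset.range N, g (2 * m) + ∑ m ∈ Finset.range N, g (2 * m + 1) := fun g N => by
    induction N with
    | zero => simp
    | succ N ih =>
      rw [show 2 * (N + 1) = 2 * N + 1 + 1 by ring, Finset.sum_range_succ, Finset.sum_range_succ,
        Finset.sum_range_succ, Finset.sum_range_succ, ih]
      ring
  rw [hsplit]
  have h0 := sum_abs_sin_arcAngle hn hk (b := 0) (Or.inl rfl)
  have h1 := sum_abs_sin_arcAngle hn hk (b := 1) (Or.inr rfl)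
  simp only [add_zero] at h0
  push_cast
  rw [h0, h1]
  ring

/-! ### Circular arcs and the curve of period 2π -/

/-- The height about the arc's axis is constant, so all differences are orthogonal to that axis and
span at most a plane. -/
theorem concyclic_image_loop {n k : ℕ} (j : ℤ) :
    EuclideanGeometry.Concyclic (loop n k '' Icc (j : ℝ) (j + 1)) := by
  constructor
  · exact ⟨0, 1, by rintro _ ⟨x, -, rfl⟩; rw [dist_zero_right, norm_loop]⟩
  · set a := axisPoint (arcAxis n k j)
    have ha : a ≠ 0 := fun h => by
      have := norm_axisPoint (arcAxis n k j); rw [show axisPoint _ = a from rfl, h] at this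
      simp at this
    have : Fact (Module.finrank ℝ E3 = 2 + 1) := ⟨finrank_euclideanSpace_fin⟩
    have hle : vectorSpan ℝ (loop n k '' Icc (j : ℝ) (j + 1)) ≤ (Submodule.span ℝ {a})ᗮ := by
      rw [vectorSpan_def, Submodule.span_le]
      rintro _ ⟨_, ⟨x, hx, rfl⟩, _, ⟨y, hy, rfl⟩, rfl⟩
      rw [SetLike.mem_coe, Submodule.mem_orthogonal_singleton_iff_inner_right]
      change inner ℝ a (loop n k x - loop n k y) = 0
      rw [inner_sub_right, inner_axisPoint, inner_axisPoint, loop_eq_piece hx, loop_eq_piece hy,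
        piece, piece, height_arc, height_arc, sub_self]
    rw [coplanar_iff_finrank_le_two]
    exact (Submodule.finrank_mono hle).trans_eq (Submodule.finrank_orthogonal_span_singleton ha)

/-- The closed curve whose image is the turned stack, over the period `2π`. -/
noncomputable def ropeCurve (n k : ℕ) (t : ℝ) : E3 := loop n k (n / Real.pi * t)

theorem hasDerivAt_ropeCurve {n : ℕ} (hn : 1 ≤ n) (k : ℕ) (t : ℝ) :
    HasDerivAt (ropeCurve n k) ((n / Real.pi) • glue (pieceDeriv n k) (n / Real.pi * t)) t := by
  have h := (hasDerivAt_loop hn k (n / Real.pi * t)).scomp t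
    ((hasDerivAt_id' t).const_mul (n / Real.pi))
  rwa [mul_one] at h

theorem deriv_ropeCurve {n : ℕ} (hn : 1 ≤ n) (k : ℕ) :
    deriv (ropeCurve n k) = fun t => (n / Real.pi) • glue (pieceDeriv n k) (n / Real.pi * t) :=
  funext fun t => (hasDerivAt_ropeCurve hn k t).deriv

theorem isClosedSphericalCurve_ropeCurve {n k : ℕ} (hn : 1 ≤ n) (hk : Nat.gcd k n = 1) :
    IsClosedSphericalCurve (ropeCurve n k) where
  contDiff := by
    rw [contDiff_one_iff_deriv]
    refine ⟨fun t => (hasDerivAt_ropeCurve hn k t).differentiableAt, ?_⟩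
    rw [deriv_ropeCurve hn]
    have h : Continuous fun t : ℝ => glue (pieceDeriv n k) (n / Real.pi * t) :=
      (continuous_loopDeriv hn k).comp (continuous_const_mul _)
    exact h.const_smul (n / Real.pi : ℝ)
  periodic t := by
    rw [ropeCurve, ropeCurve, mul_add, show n / Real.pi * (2 * Real.pi) = 2 * n by
      field_simp [Real.pi_pos.ne'], loop_add_period hn]
  simple := by
    have hπ := Real.pi_pos
    have hn0 : (0 : ℝ) < n := by exact_mod_cast hn
    have hc : (0 : ℝ) < n / Real.pi := by positivity
    intro s hs t ht hst
    have hmem : ∀ t ∈ Ico 0 (2 * Real.pi), n / Real.pi * t ∈ Ico (0 : ℝ) (2 * n) := fun t ht =>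
      ⟨mul_nonneg hc.le ht.1, by
        have := mul_lt_mul_of_pos_left ht.2 hc
        rwa [show n / Real.pi * (2 * Real.pi) = 2 * n by field_simp] at this⟩
    exact mul_left_cancel₀ hc.ne' (injOn_loop hn hk (hmem s hs) (hmem t ht) hst)
  mem_sphere t := by
    rw [mem_sphere_zero_iff_norm]; exact norm_loop _ _ _

theorem range_ropeCurve {n k : ℕ} (hn : 1 ≤ n) (hk : Nat.gcd k n = 1) :
    Set.range (ropeCurve n k) = doubleStack n 0 (2 * k * theta n) := by
  have hn0 : (0 : ℝ) < n := by exact_mod_cast hn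
  have hc : (n / Real.pi : ℝ) ≠ 0 := (div_pos hn0 Real.pi_pos).ne'
  rw [← range_loop hn hk]
  exact (mul_left_surjective₀ hc).range_comp (loop n k)

theorem length_ropeCurve {n k : ℕ} (hn : 1 ≤ n) (hk : Nat.gcd k n = 1) :
    length (ropeCurve n k) = 2 * Real.pi / Real.sin (theta n) := by
  have hn0 : (0 : ℝ) < n := by exact_mod_cast hn
  have hc : (0 : ℝ) < n / Real.pi := div_pos hn0 Real.pi_pos
  rw [length, deriv_ropeCurve hn]
  simp only [norm_smul, Real.norm_of_nonneg hc.le]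
  rw [intervalIntegral.integral_const_mul,
    intervalIntegral.mul_integral_comp_mul_left (f := fun x => ‖glue (pieceDeriv n k) x‖), mul_zero,
    show n / Real.pi * (2 * Real.pi) = 2 * n by field_simp [Real.pi_pos.ne'],
    integral_norm_loopDeriv hn hk]

theorem isPiecewiseCircular_ropeCurve {n k : ℕ} (hn : 1 ≤ n) :
    IsPiecewiseCircular (ropeCurve n k) := by
  have hn0 : (0 : ℝ) < n := by exact_mod_cast hn
  have hπ := Real.pi_pos
  have hc : (0 : ℝ) < n / Real.pi := div_pos hn0 hπ
  refine ⟨2 * n, fun i => i * (Real.pi / n), by simp, ?_, fun i _ => ?_, fun i _ => ?_⟩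
  · push_cast; field_simp
  · have : 0 < Real.pi / n := by positivity
    push_cast; linarith
  · have hcyc := concyclic_image_loop (n := n) (k := k) i
    suffices h : ropeCurve n k '' Icc (i * (Real.pi / n)) ((i + 1 : ℕ) * (Real.pi / n)) ⊆
        loop n k '' Icc ((i : ℤ) : ℝ) ((i : ℤ) + 1) from ⟨hcyc.1.subset h, hcyc.2.subset h⟩
    rintro _ ⟨t, ht, rfl⟩
    refine ⟨n / Real.pi * t, ⟨?_, ?_⟩, rfl⟩
    · have := mul_le_mul_of_nonneg_left ht.1 hc.le
      rw [show n / Real.pi * (i * (Real.pi / n)) = i by field_simp] at this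
      exact_mod_cast this
    · have := mul_le_mul_of_nonneg_left ht.2 hc.le
      rw [show n / Real.pi * ((i + 1 : ℕ) * (Real.pi / n)) = (i + 1 : ℕ) by field_simp] at this
      push_cast at this ⊢
      exact this

end SphericalRope

theorem theorem1p2 (n : ℕ) (hn : 1 ≤ n) :
    (∀ k < n, Nat.gcd k n = 1 →
      ∃ γ : ℝ → SphericalRope.E3,
        SphericalRope.IsClosedSphericalCurve γ ∧
        (∀ t, deriv γ t ≠ 0) ∧
        Set.range γ = SphericalRope.turnedStack n k ∧
        SphericalRope.IsPiecewiseCircular γ ∧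
        SphericalRope.thickness (Set.range γ) =
          ENNReal.ofReal (Real.sin (SphericalRope.theta n)) ∧
        SphericalRope.IsSphereFilling (SphericalRope.theta n) (Set.range γ) ∧
        SphericalRope.IsLongestRope (Real.sin (SphericalRope.theta n)) γ) ∧
    Set.ncard {Γ : Set SphericalRope.E3 |
      ∃ k < n, Nat.gcd k n = 1 ∧ Γ = SphericalRope.turnedStack n k} = Nat.totient n := by
  refine ⟨fun k _ hk => ?_, SphericalRope.ncard_turnedStack n⟩
  have hcurve := SphericalRope.isClosedSphericalCurve_ropeCurve hn hk
  have hrange := SphericalRope.range_ropeCurve hn hk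
  have hrange' := hrange.trans (SphericalRope.turnedStack_eq hn k).symm
  have hthick := SphericalRope.thickness_turnedStack hn k
  rw [← hrange'] at hthick
  have hn0 : (0 : ℝ) < n := by exact_mod_cast hn
  refine ⟨SphericalRope.ropeCurve n k, hcurve, fun t => ?_, hrange',
    SphericalRope.isPiecewiseCircular_ropeCurve hn, hthick, ?_, ⟨hcurve, hthick.ge⟩, ?_⟩
  · rw [SphericalRope.deriv_ropeCurve hn]
    exact smul_ne_zero (div_pos hn0 Real.pi_pos).ne' (SphericalRope.loopDeriv_ne_zero hn k _)
  · rw [hrange]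
    exact SphericalRope.isSphereFilling_doubleStack hn _ _
  -- The universal bound `2π / Θ` at `Θ = sin ϑₙ` is exactly the length of the constructed curve.
  · intro η hη
    rw [SphericalRope.length_ropeCurve hn hk]
    exact SphericalRope.length_le_of_le_thickness hη.1 (SphericalRope.sin_theta_pos hn)
      (Real.sin_le_one _) hη.2
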